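/- Setting. For every integer $m\ge 2$ let $p_{1,m},\dots,p_{m,m}$ be random variables with values in $[0,1]$ ($p$-values) on a probability space $(\Omega_m,\mathcal A_m,P_m)$, and let $\{1,\dots,m\}=I_{0,m}\sqcup I_{1,m}$ be a deterministic partition into true and false null hypotheses with $m_0:=\#I_{0,m}\ge 1$. Assume that the $(p_{i,m})_{i\in I_{0,m}}$ are independent and uniformly distributed on $[0,1]$ and that the vectors $(p_{i,m})_{i\in I_{0,m}}$ and $(p_{i,m})_{i\in I_{1,m}}$ are independent (with arbitrary dependence within the second one). Let $\widehat F_m$ be the empirical distribution function of $p_{1,m},\dots,p_{m,m}$ and $R_m(t):=m\widehat F_m(t)=\#\{i\le m: p_{i,m}\le t\}$. Given (possibly data dependent) critical values $0=c_0<c_1\le\dots\le c_m<1$, the step-up test has $R_m:=\max\{i\in\{0,\dots,m\}: p_{i:m}\le c_i\}$ rejections, where $p_{1:m}\le\dots\le p_{m:m}$ are the ordered $p$-values and $p_{0:m}:=0$; it rejects the $i$-th null hypothesis iff $p_{i,m}\le c_{R_m}$. Let $V_m:=\#\{i\in I_{0,m}: p_{i,m}\le c_{R_m}\}$ be the number of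 false rejections. The (sequence of) tests is called consistent if $V_m/R_m-E_{P_m}(V_m/R_m)\to 0$ in $P_m$-probability as $m\to\infty$, where $0/0:=0$. Fix $0<\alpha\le\lambda<1$. The BH test is the step-up test with critical values $\frac{i}{m}\alpha$, $i=0,\dots,m$. Let $\widehat m_0=\widehat m_0\big((\widehat F_m(t))_{t\ge\lambda}\big)>0$ be estimators that are measurable functions of $(\widehat F_m(t))_{t\ge\lambda}$ only. The adaptive test is the step-up test with critical values $\min\{\frac{i}{\widehat m_0}\alpha,\lambda\}$, $i=0,\dots,m$. Lemma. Suppose that (A1) $m_0/m\to\kappa_0$ for some $\kappa_0\in(0,1]$; (A3) there is some $K>0$ such that $\widehat m_0\le Km$ for all $m$; (A4) there is a constant $C>1$ with $\lim_{m\to\infty}P_m\big(\widehat m_0\ge \frac{C\alpha}{\lambda}\max\{R_m(\lambda),1\}\big)=1$; and that $\widehat m_0/m\to C_0$ in $P_m$-probability for some constant $C_0\in[\alpha\kappa_0,1]$. If $C_0=1$, suppose additionally that $P_m(\widehat m_0/m\le 1)\to 1$. Then consistency of the BH test implies consistency of the adaptive test. -/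

import Mathlib

open MeasureTheory ProbabilityTheory Filter Topology

noncomputable section

namespace AdaptiveTest

/-- The basic independence model for the `p`-values `p i`, `i : Fin m`, on the probability space
`(Ω, P)`: the hypotheses in `I₀` are the true nulls, those in the complement are the false nulls.
The true null `p`-values are i.i.d. uniform on `[0, 1]` and, as a vector, independent of the vector
of the false null `p`-values, whose joint law is arbitrary. There is at least one true null. -/
structure BasicIndependence {Ω : Type*} [MeasurableSpace Ω] (P : Measure Ω) {m : ℕ}
    (I₀ : Finset (Fin m)) (p : Fin m → Ω → ℝ) : Prop where
  measurable : ∀ i, Measurable (p i)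
  mem_Icc : ∀ i ω, p i ω ∈ Set.Icc (0 : ℝ) 1
  nonempty : I₀.Nonempty
  indep_true_false : IndepFun (fun ω (i : {i // i ∈ I₀}) => p i.1 ω)
    (fun ω (i : {i // i ∉ I₀}) => p i.1 ω) P
  indep_true : iIndepFun (fun i : {i // i ∈ I₀} => p i.1) P
  uniform : ∀ i ∈ I₀, ∀ x ∈ Set.Icc (0 : ℝ) 1, P {ω | p i ω ≤ x} = ENNReal.ofReal x

/-- `R_m(t)`: the number of `p`-values that are at most `t`. -/
def countLE {m : ℕ} (x : Fin m → ℝ) (t : ℝ) : ℕ :=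
  (Finset.univ.filter fun i => x i ≤ t).card

/-- The empirical distribution function of the `p`-values. -/
def ecdf {m : ℕ} (x : Fin m → ℝ) (t : ℝ) : ℝ :=
  (countLE x t : ℝ) / m

/-- The order statistics `x_{1:m} ≤ … ≤ x_{m:m}`, with `x_{0:m} = 0`
(and the irrelevant value `0` for an index beyond `m`). -/
def orderStat {m : ℕ} (x : Fin m → ℝ) (i : ℕ) : ℝ :=
  if h : 1 ≤ i ∧ i ≤ m then x (Tuple.sort x ⟨i - 1, by omega⟩) else 0

open Classical in
/-- The number of rejections of the step-up test with critical values `c`: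
the largest `i ∈ {0, …, m}` with `x_{i:m} ≤ c i`. -/
def stepUpR {m : ℕ} (c : ℕ → ℝ) (x : Fin m → ℝ) : ℕ :=
  Nat.findGreatest (fun i => orderStat x i ≤ c i) m

/-- The number of false rejections of the step-up test with critical values `c`, which rejects the
`i`-th hypothesis iff `x i ≤ c R` with `R` the number of rejections. -/
def stepUpV {m : ℕ} (c : ℕ → ℝ) (I₀ : Finset (Fin m)) (x : Fin m → ℝ) : ℕ :=
  (I₀.filter fun i => x i ≤ c (stepUpR c x)).card

/-- The false discovery proportion `V / R` (with `0 / 0 = 0`). -/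
def FDP {m : ℕ} (c : ℕ → ℝ) (I₀ : Finset (Fin m)) (x : Fin m → ℝ) : ℝ :=
  (stepUpV c I₀ x : ℝ) / (stepUpR c x : ℝ)

/-- The critical values of the Benjamini-Hochberg test. -/
def critBH (α : ℝ) (m : ℕ) (i : ℕ) : ℝ := (i : ℝ) / m * α

/-- The critical values of the adaptive test for the value `e` of the estimator of the number
of true nulls. -/
def critAdaptive (α lam : ℝ) (e : ℝ) (i : ℕ) : ℝ := min ((i : ℝ) / e * α) lam

/-- The estimator of the number of true nulls that is the function `g` of the empirical
distribution function restricted to `[lam, ∞)`. -/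
def estimate {lam : ℝ} {m : ℕ} (g : (Set.Ici lam → ℝ) → ℝ) (x : Fin m → ℝ) : ℝ :=
  g fun t => ecdf x t

/-- Convergence of `X m` to the constant `c` in `P m`-probability, as `m → ∞`. -/
def TendstoInProb {Ω : ℕ → Type*} [∀ m, MeasurableSpace (Ω m)] (P : ∀ m, Measure (Ω m))
    (X : ∀ m, Ω m → ℝ) (c : ℝ) : Prop :=
  ∀ ε : ℝ, 0 < ε → Tendsto (fun m => P m {ω | ε ≤ |X m ω - c|}) atTop (𝓝 0)

/-- Consistency of a sequence of tests with false discovery proportions `X m`: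
`X m - E (X m) → 0` in `P m`-probability. -/
def Consistent {Ω : ℕ → Type*} [∀ m, MeasurableSpace (Ω m)] (P : ∀ m, Measure (Ω m))
    (X : ∀ m, Ω m → ℝ) : Prop :=
  TendstoInProb P (fun m ω => X m ω - ∫ ω', X m ω' ∂(P m)) 0

end AdaptiveTest

end

open AdaptiveTest

/-!
The adaptive test is compared with the BH test through leave-one-out identities. For a true null
`j`, replacing its `p`-value by `0` changes neither the estimator nor the number of rejections on
the event that `j` is rejected. Hence the share of `j` in the false discovery proportion has
conditional expectation `α / (lam * e)` on `p j ≤ lam` given the `p`-values exceeding `lam`, where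
`e` is the estimator. The deviations of the shares from these conditional expectations are centred
and pairwise uncorrelated, so the variance of their sum is at most the sum of the second moments of
the shares. As the adaptive test rejects at least as much as the BH test, that sum is bounded by a
multiple of the corresponding sum for the BH test, which consistency of the latter forces to zero.
What remains is the number of true nulls with `p j ≤ lam` times `α / (lam * e)`, and this converges
by the law of large numbers.
-/

namespace AdaptiveTest

section StepUp

variable {m : ℕ}

lemma countLE_mono (x : Fin m → ℝ) : Monotone (countLE x) := fun _ _ h =>
  Finset.card_le_card (Finset.monotone_filter_right _ fun _ _ hi => le_trans hi h)

lemma countLE_le (x : Fin m → ℝ) (t : ℝ) : countLE x t ≤ m :=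
  (Finset.card_filter_le _ _).trans (by simp)

lemma measurable_countLE : Measurable fun z : (Fin m → ℝ) × ℝ => countLE z.1 z.2 := by
  simp only [countLE, Finset.card_filter]
  refine Finset.measurable_sum _ fun i _ => Measurable.ite ?_ measurable_const measurable_const
  exact measurableSet_le (by fun_prop) (by fun_prop)

lemma measurable_countLE_left (t : ℝ) : Measurable fun x : Fin m → ℝ => countLE x t :=
  measurable_countLE.comp (measurable_id.prodMk measurable_const)

lemma orderStat_le_iff (x : Fin m → ℝ) {i : ℕ} (hi : 1 ≤ i) (him : i ≤ m) (t : ℝ) :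
    orderStat x i ≤ t ↔ i ≤ countLE x t := by
  have hsorted := Tuple.lt_card_le_iff_apply_le_of_monotone (j := (⟨i - 1, by omega⟩ : Fin m))
    (a := t) (Tuple.monotone_sort x)
  have hcard : (Finset.univ.filter fun k => (x ∘ Tuple.sort x) k ≤ t).card = countLE x t :=
    Finset.card_equiv (Tuple.sort x) (by simp)
  rw [orderStat, dif_pos ⟨hi, him⟩, ← Function.comp_apply (f := x), ← hsorted, hcard,
    Nat.sub_lt_iff_lt_add hi, Nat.lt_add_one_iff]

lemma stepUpR_le (c : ℕ → ℝ) (x : Fin m → ℝ) : stepUpR c x ≤ m := Nat.findGreatest_le m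

lemma le_stepUpR {c : ℕ → ℝ} {x : Fin m → ℝ} {k : ℕ} (hk : k ≤ m) (h : k ≤ countLE x (c k)) :
    k ≤ stepUpR c x := by
  classical
  rcases Nat.eq_zero_or_pos k with rfl | hk0
  · exact Nat.zero_le _
  · exact Nat.le_findGreatest hk ((orderStat_le_iff x hk0 hk _).2 h)

lemma stepUpR_le_countLE (c : ℕ → ℝ) (x : Fin m → ℝ) :
    stepUpR c x ≤ countLE x (c (stepUpR c x)) := by
  classical
  rcases Nat.eq_zero_or_pos (stepUpR c x) with h0 | h0
  · omega
  · exact (orderStat_le_iff x h0 (stepUpR_le c x) _).1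
      (Nat.findGreatest_of_ne_zero (P := fun i => orderStat x i ≤ c i) (n := m) rfl h0.ne')

lemma countLE_le_stepUpR {c : ℕ → ℝ} (hc : Monotone c) (x : Fin m → ℝ) :
    countLE x (c (stepUpR c x)) ≤ stepUpR c x := by
  by_contra! h
  have := le_stepUpR (c := c) (x := x) (countLE_le x _) (countLE_mono x (hc h.le))
  omega

lemma stepUpR_mono_crit {c d : ℕ → ℝ} {x : Fin m → ℝ} (h : ∀ i ≤ m, c i ≤ d i) :
    stepUpR c x ≤ stepUpR d x :=
  le_stepUpR (stepUpR_le c x)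
    ((stepUpR_le_countLE c x).trans (countLE_mono x (h _ (stepUpR_le c x))))

lemma measurable_stepUpR {β : Type*} [MeasurableSpace β] {c : β → ℕ → ℝ} {X : β → Fin m → ℝ}
    (hc : ∀ i, Measurable fun b => c b i) (hX : Measurable X) :
    Measurable fun b => stepUpR (c b) (X b) := by
  classical
  refine measurable_findGreatest fun k hk => ?_
  rcases Nat.eq_zero_or_pos k with rfl | hk0
  · simp only [orderStat]
    exact measurableSet_le (by simp) (hc 0)
  · simp only [orderStat_le_iff _ hk0 hk]
    exact measurableSet_le measurable_const (measurable_countLE.comp (hX.prodMk (hc k)))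

lemma FDP_congr {c d : ℕ → ℝ} (h : ∀ i ≤ m, c i = d i) (I : Finset (Fin m)) (x : Fin m → ℝ) :
    FDP c I x = FDP d I x := by
  have hR : stepUpR c x = stepUpR d x :=
    le_antisymm (stepUpR_mono_crit fun i hi => (h i hi).le)
      (stepUpR_mono_crit fun i hi => (h i hi).ge)
  rw [FDP, FDP, stepUpV, stepUpV, hR, h _ (stepUpR_le d x)]

lemma stepUpV_le_stepUpR {c : ℕ → ℝ} (hc : Monotone c) (I : Finset (Fin m)) (x : Fin m → ℝ) :
    stepUpV c I x ≤ stepUpR c x :=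
  (Finset.card_le_card (Finset.filter_subset_filter _ (Finset.subset_univ _))).trans
    (countLE_le_stepUpR hc x)

lemma FDP_mem_Icc {c : ℕ → ℝ} (hc : Monotone c) (I : Finset (Fin m)) (x : Fin m → ℝ) :
    FDP c I x ∈ Set.Icc (0 : ℝ) 1 :=
  ⟨by unfold FDP; positivity,
    div_le_one_of_le₀ (by exact_mod_cast stepUpV_le_stepUpR hc I x) (by positivity)⟩

lemma countLE_le_countLE_update_zero (x : Fin m → ℝ) (j : Fin m) {t : ℝ} (ht : 0 ≤ t) :
    countLE x t ≤ countLE (Function.update x j 0) t := by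
  refine Finset.card_le_card fun i => ?_
  simp only [Finset.mem_filter, Finset.mem_univ, true_and]
  intro hi
  rcases eq_or_ne i j with rfl | hij
  · simpa using ht
  · simpa [hij] using hi

lemma countLE_update_zero (x : Fin m → ℝ) (j : Fin m) {t : ℝ} (ht : 0 ≤ t) (hj : x j ≤ t) :
    countLE (Function.update x j 0) t = countLE x t := by
  refine congrArg Finset.card (Finset.filter_congr fun i _ => ?_)
  rcases eq_or_ne i j with rfl | hij
  · simp [ht, hj]
  · simp [hij]

lemma one_le_stepUpR_update_zero {c : ℕ → ℝ} (h0 : ∀ i, 0 ≤ c i) (x : Fin m → ℝ) (j : Fin m) :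
    1 ≤ stepUpR c (Function.update x j 0) :=
  le_stepUpR (by have := j.isLt; omega) (Finset.card_pos.2 ⟨j, by simp [h0 1]⟩)

lemma stepUpR_le_stepUpR_update_zero {c : ℕ → ℝ} (h0 : ∀ i, 0 ≤ c i) (x : Fin m → ℝ)
    (j : Fin m) : stepUpR c x ≤ stepUpR c (Function.update x j 0) :=
  le_stepUpR (stepUpR_le c x)
    ((stepUpR_le_countLE c x).trans (countLE_le_countLE_update_zero x j (h0 _)))

lemma stepUpR_update_zero {c : ℕ → ℝ} (h0 : ∀ i, 0 ≤ c i) (x : Fin m → ℝ) (j : Fin m)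
    (hj : x j ≤ c (stepUpR c (Function.update x j 0))) :
    stepUpR c (Function.update x j 0) = stepUpR c x := by
  refine le_antisymm (le_stepUpR (stepUpR_le _ _) ?_) (stepUpR_le_stepUpR_update_zero h0 x j)
  rw [← countLE_update_zero x j (h0 _) hj]
  exact stepUpR_le_countLE c _

lemma le_crit_stepUpR_iff_update_zero {c : ℕ → ℝ} (hc : Monotone c) (h0 : ∀ i, 0 ≤ c i)
    (x : Fin m → ℝ) (j : Fin m) :
    x j ≤ c (stepUpR c x) ↔ x j ≤ c (stepUpR c (Function.update x j 0)) :=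
  ⟨fun h => h.trans (hc (stepUpR_le_stepUpR_update_zero h0 x j)),
    fun h => by rwa [← stepUpR_update_zero h0 x j h]⟩

lemma critAdaptive_mono {α lam e : ℝ} (hα : 0 ≤ α) (he : 0 ≤ e) :
    Monotone (critAdaptive α lam e) := fun i j hij => by
  unfold critAdaptive
  gcongr

lemma critAdaptive_nonneg {α lam e : ℝ} (hα : 0 ≤ α) (hl : 0 ≤ lam) (he : 0 ≤ e) (i : ℕ) :
    0 ≤ critAdaptive α lam e i := by
  unfold critAdaptive; positivity

lemma critBH_mono {α : ℝ} (hα : 0 ≤ α) (m : ℕ) : Monotone (critBH α m) := fun i j hij => by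
  unfold critBH
  gcongr

lemma critBH_eq_critAdaptive {α lam : ℝ} (hα : 0 ≤ α) (hαlam : α ≤ lam) {i : ℕ} (hi : i ≤ m) :
    critBH α m i = critAdaptive α lam m i := by
  have h : (i : ℝ) / m ≤ 1 := div_le_one_of_le₀ (by exact_mod_cast hi) (by positivity)
  rw [critBH, critAdaptive, min_eq_left]
  nlinarith

lemma critAdaptive_anti {α lam e f : ℝ} (hα : 0 ≤ α) (he : 0 < e) (hef : e ≤ f) (i : ℕ) :
    critAdaptive α lam f i ≤ critAdaptive α lam e i := by
  unfold critAdaptive; gcongr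

end StepUp

section Independence

variable {Ω : Type*} [MeasurableSpace Ω] {P : Measure Ω}

lemma indepFun_prodMk_of_indepFun {β γ δ : Type*} [MeasurableSpace β]
    [MeasurableSpace γ] [MeasurableSpace δ] [IsProbabilityMeasure P]
    {X : Ω → β} {Y : Ω → γ} {Z : Ω → δ} (hX : Measurable X) (hY : Measurable Y) (hZ : Measurable Z)
    (hXY : IndepFun X Y P) (hXYZ : IndepFun (fun ω => (X ω, Y ω)) Z P) :
    IndepFun X (fun ω => (Y ω, Z ω)) P := by
  have : IsProbabilityMeasure (P.map X) := Measure.isProbabilityMeasure_map hX.aemeasurable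
  have : IsProbabilityMeasure (P.map Y) := Measure.isProbabilityMeasure_map hY.aemeasurable
  have : IsProbabilityMeasure (P.map Z) := Measure.isProbabilityMeasure_map hZ.aemeasurable
  have hYZ : IndepFun Y Z P := hXYZ.comp measurable_snd measurable_id
  rw [indepFun_iff_map_prod_eq_prod_map_map hX.aemeasurable (hY.prodMk hZ).aemeasurable,
    (indepFun_iff_map_prod_eq_prod_map_map hY.aemeasurable hZ.aemeasurable).1 hYZ,
    ← Measure.prodAssoc_prod,
    ← (indepFun_iff_map_prod_eq_prod_map_map hX.aemeasurable hY.aemeasurable).1 hXY,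
    ← (indepFun_iff_map_prod_eq_prod_map_map (hX.prodMk hY).aemeasurable hZ.aemeasurable).1 hXYZ,
    Measure.map_map (MeasurableEquiv.measurable _) (by fun_prop)]
  rfl

lemma indepFun_update_zero_of_iIndepFun {ι : Type*} [Finite ι] [DecidableEq ι] {X : ι → Ω → ℝ}
    (hX : iIndepFun X P) (hXm : ∀ i, Measurable (X i)) (j : ι) :
    IndepFun (X j) (fun ω => Function.update (fun i => X i ω) j 0) P := by
  have := Fintype.ofFinite ι
  have hind := hX.indepFun_finset {j} {j}ᶜ disjoint_compl_right hXm
  let extend : (({j}ᶜ : Finset ι) → ℝ) → ι → ℝ := fun f i =>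
    if h : i ∈ ({j}ᶜ : Finset ι) then f ⟨i, h⟩ else 0
  have hextend : Measurable extend := measurable_pi_iff.2 fun i => by
    by_cases h : i ∈ ({j}ᶜ : Finset ι)
    · simpa only [extend, dif_pos h] using measurable_pi_apply _
    · simpa only [extend, dif_neg h] using measurable_const
  have hX' : IndepFun (X j) _ P :=
    hind.comp (φ := fun f : ({j} : Finset ι) → ℝ => f ⟨j, Finset.mem_singleton_self j⟩)
      (measurable_pi_apply _) hextend
  convert hX' using 1
  funext ω i
  rcases eq_or_ne i j with rfl | hij
  · simp [extend]
  · simp [extend, hij]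

lemma integral_ite_le_of_indepFun {β : Type*} [MeasurableSpace β] [IsProbabilityMeasure P]
    {U : Ω → ℝ} {Y : Ω → β} (hU : Measurable U) (hY : Measurable Y) (hUY : IndepFun U Y P)
    (huniform : ∀ t ∈ Set.Icc (0 : ℝ) 1, P {ω | U ω ≤ t} = ENNReal.ofReal t)
    {b h : β → ℝ} (hb : Measurable b) (hb01 : ∀ y, b y ∈ Set.Icc (0 : ℝ) 1) (hh : Measurable h)
    (hint : Integrable (fun ω => h (Y ω)) P) :
    ∫ ω, (if U ω ≤ b (Y ω) then h (Y ω) else 0) ∂P = ∫ ω, b (Y ω) * h (Y ω) ∂P := by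
  have : IsProbabilityMeasure (P.map U) := Measure.isProbabilityMeasure_map hU.aemeasurable
  have : IsProbabilityMeasure (P.map Y) := Measure.isProbabilityMeasure_map hY.aemeasurable
  have hset : MeasurableSet {z : ℝ × β | z.1 ≤ b z.2} :=
    measurableSet_le (by fun_prop) (by fun_prop)
  have hmeas : Measurable fun z : ℝ × β => if z.1 ≤ b z.2 then h z.2 else 0 :=
    Measurable.ite hset (by fun_prop) measurable_const
  have hint' : Integrable (fun z : ℝ × β => if z.1 ≤ b z.2 then h z.2 else 0)
      ((P.map U).prod (P.map Y)) :=
    (((integrable_map_measure hh.aestronglyMeasurable hY.aemeasurable).2 hint).comp_snd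
      (P.map U)).indicator hset
  have hsection (y : β) : ∫ u, (if u ≤ b y then h y else 0) ∂(P.map U) = b y * h y := by
    calc ∫ u, (if u ≤ b y then h y else 0) ∂(P.map U)
        = ∫ u, (Set.Iic (b y)).indicator (fun _ => h y) u ∂(P.map U) := rfl
      _ = (P.map U).real (Set.Iic (b y)) * h y := integral_indicator_const _ measurableSet_Iic
      _ = P.real {ω | U ω ≤ b y} * h y := by
        rw [map_measureReal_apply hU measurableSet_Iic]
        rfl
      _ = b y * h y := by
        rw [Measure.real, huniform _ (hb01 y), ENNReal.toReal_ofReal (hb01 y).1]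
  calc ∫ ω, (if U ω ≤ b (Y ω) then h (Y ω) else 0) ∂P
      = ∫ z, (if z.1 ≤ b z.2 then h z.2 else 0) ∂((P.map U).prod (P.map Y)) := by
        rw [← (indepFun_iff_map_prod_eq_prod_map_map hU.aemeasurable hY.aemeasurable).1 hUY,
          integral_map (hU.prodMk hY).aemeasurable hmeas.aestronglyMeasurable]
    _ = ∫ y, b y * h y ∂(P.map Y) := by
        rw [integral_prod_symm _ hint']
        exact integral_congr_ae (Eventually.of_forall hsection)
    _ = ∫ ω, b (Y ω) * h (Y ω) ∂P :=
        integral_map hY.aemeasurable (hb.mul hh).aestronglyMeasurable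

/-- The `j`-th coordinate of the random vector `X` is uniformly distributed on `[0, 1]` and
independent of the other coordinates. The latter are encoded by the vector `X` with its `j`-th
coordinate replaced by `0`, which is also the `p`-value vector used in leave-one-out arguments. -/
structure IndepUniformCoord {ι : Type*} [DecidableEq ι] (P : Measure Ω) (X : Ω → ι → ℝ) (j : ι) :
    Prop where
  measurable : Measurable X
  indepFun : IndepFun (fun ω => X ω j) (fun ω => Function.update (X ω) j 0) P
  uniform : ∀ t ∈ Set.Icc (0 : ℝ) 1, P {ω | X ω j ≤ t} = ENNReal.ofReal t

lemma IndepUniformCoord.update_zero {ι : Type*} [DecidableEq ι] {X : Ω → ι → ℝ} {j k : ι}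
    (hX : IndepUniformCoord P X k) (hkj : k ≠ j) :
    IndepUniformCoord P (fun ω => Function.update (X ω) j 0) k where
  measurable := measurable_update_left.comp hX.measurable
  indepFun := by
    have h := hX.indepFun.comp measurable_id (measurable_update_left (a := j) (x := (0 : ℝ)))
    simpa only [Function.comp_def, id_eq, Function.update_of_ne hkj, Function.update_comm hkj]
      using h
  uniform := by simpa only [Function.update_of_ne hkj] using hX.uniform

lemma BasicIndependence.measurable_pi {m : ℕ} {I : Finset (Fin m)} {p : Fin m → Ω → ℝ}
    (h : BasicIndependence P I p) : Measurable fun ω i => p i ω := measurable_pi_iff.2 h.measurable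

lemma BasicIndependence.indepUniformCoord [IsProbabilityMeasure P] {m : ℕ} {I : Finset (Fin m)}
    {p : Fin m → Ω → ℝ} (h : BasicIndependence P I p) {j : Fin m} (hj : j ∈ I) :
    IndepUniformCoord P (fun ω i => p i ω) j where
  measurable := h.measurable_pi
  uniform := h.uniform j hj
  indepFun := by
    let others : Ω → {i // i ∈ I} → ℝ := fun ω => Function.update (fun i => p i.1 ω) ⟨j, hj⟩ 0
    have hothers : Measurable others :=
      measurable_update_left.comp (measurable_pi_iff.2 fun i => h.measurable i.1)
    have htrue : IndepFun (p j) others P :=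
      indepFun_update_zero_of_iIndepFun h.indep_true (fun i => h.measurable i.1) ⟨j, hj⟩
    have hfalse : IndepFun (fun ω => (p j ω, others ω)) (fun ω (i : {i // i ∉ I}) => p i.1 ω) P :=
      h.indep_true_false.comp
        (φ := fun f => (f ⟨j, hj⟩, Function.update f ⟨j, hj⟩ 0)) (ψ := id)
        ((measurable_pi_apply _).prodMk measurable_update_left) measurable_id
    have hglued : IndepFun (p j) _ P := (indepFun_prodMk_of_indepFun (h.measurable j) hothers
      (measurable_pi_iff.2 fun i => h.measurable i.1) htrue hfalse).comp measurable_id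
      (MeasurableEquiv.piEquivPiSubtypeProd (fun _ : Fin m => ℝ) (· ∈ I)).symm.measurable
    convert hglued using 1
    funext ω i
    by_cases hi : i ∈ I
    · simp [MeasurableEquiv.piEquivPiSubtypeProd, Equiv.piEquivPiSubtypeProd, others,
        Function.update_apply, hi]
    · have hij : i ≠ j := fun hij => hi (hij ▸ hj)
      simp [MeasurableEquiv.piEquivPiSubtypeProd, Equiv.piEquivPiSubtypeProd, hi, hij]

end Independence

section Shares

variable {m : ℕ} {α lam : ℝ} {e f : (Fin m → ℝ) → ℝ}

/-- The function `f` of the `p`-values only depends on the `p`-values exceeding `lam` and on the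
set of the others. This abstracts functions of the empirical distribution function on
`[lam, ∞)`. -/
def InvariantBelow (lam : ℝ) (f : (Fin m → ℝ) → ℝ) : Prop :=
  ∀ x j, x j ≤ lam → f (Function.update x j 0) = f x

/-- The estimators for which the adaptive test of level `α` with tuning parameter `lam` satisfies
the leave-one-out identities: the lower bound keeps the truncation of the critical values at `lam`
from being active. -/
structure Admissible (α lam : ℝ) (e : (Fin m → ℝ) → ℝ) : Prop where
  level_pos : 0 < α
  threshold_pos : 0 < lam
  threshold_le_one : lam ≤ 1
  measurable : Measurable e
  invariantBelow : InvariantBelow lam e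
  le_estimator : ∀ x, α / lam * max (countLE x lam : ℝ) 1 ≤ e x

/-- The number of rejections of the adaptive test with estimator `e`. -/
noncomputable def adaptiveR (α lam : ℝ) (e : (Fin m → ℝ) → ℝ) (x : Fin m → ℝ) : ℕ :=
  stepUpR (critAdaptive α lam (e x)) x

/-- The adaptive test with estimator `e` rejects the hypotheses with `p`-value at most this. -/
noncomputable def adaptiveThreshold (α lam : ℝ) (e : (Fin m → ℝ) → ℝ) (x : Fin m → ℝ) : ℝ :=
  critAdaptive α lam (e x) (adaptiveR α lam e x)

/-- The contribution of the `j`-th hypothesis to the false discovery proportion of the adaptive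
test with estimator `e`. -/
noncomputable def rejShare (α lam : ℝ) (e : (Fin m → ℝ) → ℝ) (j : Fin m) (x : Fin m → ℝ) : ℝ :=
  if x j ≤ adaptiveThreshold α lam e x then (adaptiveR α lam e x : ℝ)⁻¹ else 0

/-- For a true null hypothesis `j`, the conditional expectation of `rejShare α lam e j` given the
`p`-values exceeding `lam`. -/
noncomputable def lowShare (α lam : ℝ) (e : (Fin m → ℝ) → ℝ) (j : Fin m) (x : Fin m → ℝ) : ℝ :=
  if x j ≤ lam then α / (lam * e x) else 0

/-- The deviation of `rejShare` from its conditional expectation `lowShare`. -/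
noncomputable def excessShare (α lam : ℝ) (e : (Fin m → ℝ) → ℝ) (j : Fin m) (x : Fin m → ℝ) : ℝ :=
  rejShare α lam e j x - lowShare α lam e j x

lemma FDP_eq_sum_rejShare (I : Finset (Fin m)) (x : Fin m → ℝ) :
    FDP (critAdaptive α lam (e x)) I x = ∑ j ∈ I, rejShare α lam e j x := by
  rw [FDP, stepUpV, Finset.card_filter, Nat.cast_sum, Finset.sum_div]
  refine Finset.sum_congr rfl fun j _ => ?_
  simp only [Nat.cast_ite, Nat.cast_one, Nat.cast_zero, ite_div, one_div, zero_div]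
  rfl

lemma sum_lowShare (I : Finset (Fin m)) (x : Fin m → ℝ) :
    ∑ j ∈ I, lowShare α lam e j x =
      ((I.filter fun j => x j ≤ lam).card : ℝ) * (α / (lam * e x)) := by
  simp only [lowShare, ← Finset.sum_filter, Finset.sum_const, nsmul_eq_mul]

lemma FDP_eq_sum_excessShare_add (I : Finset (Fin m)) (x : Fin m → ℝ) :
    FDP (critAdaptive α lam (e x)) I x = ∑ j ∈ I, excessShare α lam e j x +
      ((I.filter fun j => x j ≤ lam).card : ℝ) * (α / (lam * e x)) := by
  rw [FDP_eq_sum_rejShare, ← sum_lowShare, ← Finset.sum_add_distrib]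
  simp only [excessShare, sub_add_cancel]

lemma rejShare_mem_Icc (j : Fin m) (x : Fin m → ℝ) :
    rejShare α lam e j x ∈ Set.Icc (0 : ℝ) 1 := by
  unfold rejShare
  split_ifs
  · exact ⟨by positivity, Nat.cast_inv_le_one _⟩
  · exact ⟨le_rfl, zero_le_one⟩

lemma abs_rejShare_le_one (j : Fin m) (x : Fin m → ℝ) : |rejShare α lam e j x| ≤ 1 :=
  (abs_of_nonneg (rejShare_mem_Icc j x).1).trans_le (rejShare_mem_Icc j x).2

lemma measurable_critAdaptive (he : Measurable e) (i : ℕ) :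
    Measurable fun x => critAdaptive α lam (e x) i := by
  unfold critAdaptive; fun_prop

lemma measurable_adaptiveR (he : Measurable e) : Measurable (adaptiveR α lam e) :=
  measurable_stepUpR (measurable_critAdaptive he) measurable_id

lemma measurable_adaptiveThreshold (he : Measurable e) :
    Measurable (adaptiveThreshold α lam e) :=
  (measurable_from_prod_countable_left
    (f := fun z : (Fin m → ℝ) × ℕ => critAdaptive α lam (e z.1) z.2)
    (measurable_critAdaptive he)).comp (measurable_id.prodMk (measurable_adaptiveR he))

lemma measurable_rejShare (he : Measurable e) (j : Fin m) : Measurable (rejShare α lam e j) :=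
  Measurable.ite (measurableSet_le (measurable_pi_apply j) (measurable_adaptiveThreshold he))
    (measurable_from_nat.comp (measurable_adaptiveR he)).inv measurable_const

lemma measurable_lowShare (he : Measurable e) (j : Fin m) : Measurable (lowShare α lam e j) :=
  Measurable.ite (measurableSet_le (measurable_pi_apply j) measurable_const) (by fun_prop)
    measurable_const

lemma measurable_excessShare (he : Measurable e) (j : Fin m) :
    Measurable (excessShare α lam e j) :=
  (measurable_rejShare he j).sub (measurable_lowShare he j)

lemma adaptiveThreshold_le (x : Fin m → ℝ) : adaptiveThreshold α lam e x ≤ lam :=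
  min_le_right _ _

namespace Admissible

variable (he : Admissible α lam e)
include he

lemma level_le_mul (x : Fin m → ℝ) : α ≤ lam * e x := by
  have hone : α / lam * 1 ≤ α / lam * max (countLE x lam : ℝ) 1 :=
    mul_le_mul_of_nonneg_left (le_max_right _ _) (div_pos he.level_pos he.threshold_pos).le
  rw [← div_le_iff₀' he.threshold_pos, ← mul_one (α / lam)]
  exact hone.trans (he.le_estimator x)

lemma pos (x : Fin m → ℝ) : 0 < e x :=
  pos_of_mul_pos_right (he.level_pos.trans_le (he.level_le_mul x)) he.threshold_pos.le

lemma critAdaptive_nonneg (x : Fin m → ℝ) (i : ℕ) : 0 ≤ critAdaptive α lam (e x) i :=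
  AdaptiveTest.critAdaptive_nonneg he.level_pos.le he.threshold_pos.le (he.pos x).le i

lemma adaptiveThreshold_mem_Icc (x : Fin m → ℝ) :
    adaptiveThreshold α lam e x ∈ Set.Icc (0 : ℝ) 1 :=
  ⟨he.critAdaptive_nonneg x _, (adaptiveThreshold_le x).trans he.threshold_le_one⟩

lemma adaptiveThreshold_eq (x : Fin m → ℝ) :
    adaptiveThreshold α lam e x = (adaptiveR α lam e x : ℝ) / e x * α := by
  have hR : (adaptiveR α lam e x : ℝ) ≤ max (countLE x lam : ℝ) 1 :=
    le_max_of_le_left <| Nat.cast_le.2 <|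
      (stepUpR_le_countLE _ _).trans (countLE_mono x (adaptiveThreshold_le x))
  have hle : α / lam * (adaptiveR α lam e x : ℝ) ≤ e x :=
    (mul_le_mul_of_nonneg_left hR (div_pos he.level_pos he.threshold_pos).le).trans
      (he.le_estimator x)
  refine min_eq_left ?_
  rw [div_mul_eq_mul_div, div_le_iff₀ (he.pos x)]
  rw [div_mul_eq_mul_div, div_le_iff₀ he.threshold_pos] at hle
  linarith

lemma one_le_adaptiveR_update_zero (x : Fin m → ℝ) (j : Fin m) :
    1 ≤ adaptiveR α lam e (Function.update x j 0) :=
  one_le_stepUpR_update_zero (he.critAdaptive_nonneg _) x j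

lemma adaptiveThreshold_mul_inv (x : Fin m → ℝ) (j : Fin m) :
    adaptiveThreshold α lam e (Function.update x j 0) *
      (adaptiveR α lam e (Function.update x j 0) : ℝ)⁻¹ = α / e (Function.update x j 0) := by
  have hR : (adaptiveR α lam e (Function.update x j 0) : ℝ) ≠ 0 :=
    Nat.cast_ne_zero.2 (Nat.one_le_iff_ne_zero.1 (he.one_le_adaptiveR_update_zero x j))
  rw [he.adaptiveThreshold_eq]
  field_simp

lemma le_adaptiveThreshold_iff (x : Fin m → ℝ) (j : Fin m) :
    x j ≤ adaptiveThreshold α lam e x ↔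
      x j ≤ adaptiveThreshold α lam e (Function.update x j 0) := by
  by_cases hj : x j ≤ lam
  · rw [adaptiveThreshold, adaptiveThreshold, adaptiveR, adaptiveR, he.invariantBelow x j hj]
    exact le_crit_stepUpR_iff_update_zero (critAdaptive_mono he.level_pos.le (he.pos x).le)
      (he.critAdaptive_nonneg x) x j
  · exact iff_of_false (fun h => hj (h.trans (adaptiveThreshold_le _)))
      (fun h => hj (h.trans (adaptiveThreshold_le _)))

lemma adaptiveR_update_zero {x : Fin m → ℝ} {j : Fin m} (hj : x j ≤ adaptiveThreshold α lam e x) :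
    adaptiveR α lam e (Function.update x j 0) = adaptiveR α lam e x := by
  have hinv := he.invariantBelow x j (hj.trans (adaptiveThreshold_le x))
  rw [he.le_adaptiveThreshold_iff, adaptiveThreshold, adaptiveR, hinv] at hj
  rw [adaptiveR, adaptiveR, hinv]
  exact stepUpR_update_zero (he.critAdaptive_nonneg x) x j hj

lemma rejShare_eq (j : Fin m) (x : Fin m → ℝ) :
    rejShare α lam e j x = if x j ≤ adaptiveThreshold α lam e (Function.update x j 0) then
      (adaptiveR α lam e (Function.update x j 0) : ℝ)⁻¹ else 0 := by
  rw [rejShare]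
  by_cases hj : x j ≤ adaptiveThreshold α lam e x
  · rw [if_pos hj, if_pos ((he.le_adaptiveThreshold_iff x j).1 hj), he.adaptiveR_update_zero hj]
  · rw [if_neg hj, if_neg (mt (he.le_adaptiveThreshold_iff x j).2 hj)]

lemma rejShare_self_update_zero (x : Fin m → ℝ) (j : Fin m) :
    rejShare α lam e j (Function.update x j 0) =
      (adaptiveR α lam e (Function.update x j 0) : ℝ)⁻¹ :=
  if_pos (by simpa using (he.adaptiveThreshold_mem_Icc _).1)

lemma rejShare_update_zero {x : Fin m → ℝ} {j : Fin m} (hj : x j ≤ adaptiveThreshold α lam e x)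
    (k : Fin m) : rejShare α lam e k (Function.update x j 0) = rejShare α lam e k x := by
  have hR := he.adaptiveR_update_zero hj
  rcases eq_or_ne k j with rfl | hkj
  · rw [he.rejShare_self_update_zero, hR, rejShare, if_pos hj]
  · rw [rejShare, rejShare, adaptiveThreshold, adaptiveThreshold, hR,
      he.invariantBelow x j (hj.trans (adaptiveThreshold_le x)), Function.update_of_ne hkj]

lemma invariantBelow_lowShare (k : Fin m) : InvariantBelow lam (lowShare α lam e k) := by
  intro x j hj
  rw [lowShare, lowShare, he.invariantBelow x j hj]
  rcases eq_or_ne k j with rfl | hkj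
  · simp [hj, he.threshold_pos.le]
  · rw [Function.update_of_ne hkj]

lemma excessShare_update_zero {x : Fin m → ℝ} {j : Fin m}
    (hj : x j ≤ adaptiveThreshold α lam e x) (k : Fin m) :
    excessShare α lam e k (Function.update x j 0) = excessShare α lam e k x := by
  rw [excessShare, excessShare, he.rejShare_update_zero hj,
    he.invariantBelow_lowShare k x j (hj.trans (adaptiveThreshold_le x))]

lemma div_mem_Icc (x : Fin m → ℝ) : α / (lam * e x) ∈ Set.Icc (0 : ℝ) 1 :=
  have hpos : 0 < lam * e x := mul_pos he.threshold_pos (he.pos x)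
  ⟨div_nonneg he.level_pos.le hpos.le, (div_le_one hpos).2 (he.level_le_mul x)⟩

lemma lowShare_mem_Icc (j : Fin m) (x : Fin m → ℝ) :
    lowShare α lam e j x ∈ Set.Icc (0 : ℝ) 1 := by
  unfold lowShare
  split_ifs
  · exact he.div_mem_Icc x
  · exact ⟨le_rfl, zero_le_one⟩

lemma abs_excessShare_le_one (j : Fin m) (x : Fin m → ℝ) : |excessShare α lam e j x| ≤ 1 :=
  abs_sub_le_of_nonneg_of_le (rejShare_mem_Icc j x).1 (rejShare_mem_Icc j x).2
    (he.lowShare_mem_Icc j x).1 (he.lowShare_mem_Icc j x).2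

end Admissible

lemma admissible_const {α : ℝ} (hα : 0 < α) (hα1 : α ≤ 1) (hm : 1 ≤ m) :
    Admissible α 1 (fun _ : Fin m → ℝ => (m : ℝ)) where
  level_pos := hα
  threshold_pos := one_pos
  threshold_le_one := le_rfl
  measurable := measurable_const
  invariantBelow _ _ _ := rfl
  le_estimator x := by
    have hmax : max (countLE x 1 : ℝ) 1 ≤ m :=
      max_le (by exact_mod_cast countLE_le x 1) (by exact_mod_cast hm)
    rw [div_one]
    exact (mul_le_of_le_one_left (by positivity) hα1).trans hmax

lemma FDP_critBH_eq_sum_rejShare {α : ℝ} (hα : 0 ≤ α) (hα1 : α ≤ 1) (I : Finset (Fin m))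
    (x : Fin m → ℝ) :
    FDP (critBH α m) I x = ∑ j ∈ I, rejShare α 1 (fun _ => (m : ℝ)) j x := by
  rw [← FDP_eq_sum_rejShare]
  exact FDP_congr (fun i hi => critBH_eq_critAdaptive hα hα1 hi) I x

end Shares

section Moments

variable {m : ℕ} {α lam : ℝ} {e f : (Fin m → ℝ) → ℝ} {Ω : Type*} [MeasurableSpace Ω]
  {P : Measure Ω} [IsProbabilityMeasure P] {X : Ω → Fin m → ℝ} {j k : Fin m}

lemma memLp_comp_of_abs_le {β : Type*} [MeasurableSpace β] {Y : Ω → β} {ψ : β → ℝ} {B : ℝ}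
    (hψ : Measurable ψ) (hY : Measurable Y) (hB : ∀ y, |ψ y| ≤ B) (q : ENNReal) :
    MemLp (fun ω => ψ (Y ω)) q P :=
  MemLp.of_bound (hψ.comp hY).aestronglyMeasurable B (ae_of_all _ fun ω => hB (Y ω))

lemma integrable_comp_of_abs_le {β : Type*} [MeasurableSpace β] {Y : Ω → β} {ψ : β → ℝ} {B : ℝ}
    (hψ : Measurable ψ) (hY : Measurable Y) (hB : ∀ y, |ψ y| ≤ B) :
    Integrable (fun ω => ψ (Y ω)) P :=
  memLp_one_iff_integrable.1 (memLp_comp_of_abs_le hψ hY hB 1)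

namespace Admissible

variable (he : Admissible α lam e)
include he

lemma div_estimator_mem_Icc (x : Fin m → ℝ) : α / e x ∈ Set.Icc (0 : ℝ) 1 :=
  ⟨(div_pos he.level_pos (he.pos x)).le, (div_le_one (he.pos x)).2 <|
    (he.level_le_mul x).trans (mul_le_of_le_one_left (he.pos x).le he.threshold_le_one)⟩

lemma integral_rejShare_mul (hX : IndepUniformCoord P X j) {ψ : (Fin m → ℝ) → ℝ}
    (hψ : Measurable ψ) {B : ℝ} (hB : ∀ x, |ψ x| ≤ B)
    (hinv : ∀ x, x j ≤ adaptiveThreshold α lam e x → ψ (Function.update x j 0) = ψ x) :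
    ∫ ω, rejShare α lam e j (X ω) * ψ (X ω) ∂P =
      ∫ ω, α / e (Function.update (X ω) j 0) * ψ (Function.update (X ω) j 0) ∂P := by
  have hY : Measurable fun ω => Function.update (X ω) j 0 :=
    measurable_update_left.comp hX.measurable
  have hh : Measurable fun y => (adaptiveR α lam e y : ℝ)⁻¹ * ψ y :=
    (measurable_from_nat.comp (measurable_adaptiveR he.measurable)).inv.mul hψ
  have hhB (y : Fin m → ℝ) : |(adaptiveR α lam e y : ℝ)⁻¹ * ψ y| ≤ B := by
    rw [abs_mul, abs_of_nonneg (by positivity)]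
    exact (mul_le_of_le_one_left (abs_nonneg _) (Nat.cast_inv_le_one _)).trans (hB y)
  have hloo (x : Fin m → ℝ) : rejShare α lam e j x * ψ x =
      if x j ≤ adaptiveThreshold α lam e (Function.update x j 0) then
        (adaptiveR α lam e (Function.update x j 0) : ℝ)⁻¹ * ψ (Function.update x j 0) else 0 := by
    rw [he.rejShare_eq, ite_mul, zero_mul]
    exact ite_congr rfl (fun hj => by rw [hinv x ((he.le_adaptiveThreshold_iff x j).2 hj)])
      fun _ => rfl
  simp only [hloo]
  rw [integral_ite_le_of_indepFun (hX.measurable.eval) hY hX.indepFun hX.uniform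
    (measurable_adaptiveThreshold he.measurable) he.adaptiveThreshold_mem_Icc hh
    (integrable_comp_of_abs_le hh hY hhB)]
  simp only [← mul_assoc, he.adaptiveThreshold_mul_inv]

lemma integral_lowShare_mul (hX : IndepUniformCoord P X j) {ψ : (Fin m → ℝ) → ℝ}
    (hψ : Measurable ψ) {B : ℝ} (hB : ∀ x, |ψ x| ≤ B) (hinv : InvariantBelow lam ψ) :
    ∫ ω, lowShare α lam e j (X ω) * ψ (X ω) ∂P =
      ∫ ω, α / e (Function.update (X ω) j 0) * ψ (Function.update (X ω) j 0) ∂P := by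
  have hY : Measurable fun ω => Function.update (X ω) j 0 :=
    measurable_update_left.comp hX.measurable
  have hh : Measurable fun y => α / (lam * e y) * ψ y :=
    (measurable_const.div (he.measurable.const_mul lam)).mul hψ
  have hhB (y : Fin m → ℝ) : |α / (lam * e y) * ψ y| ≤ B := by
    rw [abs_mul, abs_of_nonneg (he.div_mem_Icc y).1]
    exact (mul_le_of_le_one_left (abs_nonneg _) (he.div_mem_Icc y).2).trans (hB y)
  have hloo (x : Fin m → ℝ) : lowShare α lam e j x * ψ x = if x j ≤ lam then
      α / (lam * e (Function.update x j 0)) * ψ (Function.update x j 0) else 0 := by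
    rw [lowShare, ite_mul, zero_mul]
    exact ite_congr rfl (fun hj => by rw [hinv x j hj, he.invariantBelow x j hj]) fun _ => rfl
  simp only [hloo]
  rw [integral_ite_le_of_indepFun (hX.measurable.eval) hY hX.indepFun hX.uniform
    (b := fun _ => lam) measurable_const (fun _ => ⟨he.threshold_pos.le, he.threshold_le_one⟩) hh
    (integrable_comp_of_abs_le hh hY hhB)]
  refine integral_congr_ae (ae_of_all _ fun ω => ?_)
  have := he.threshold_pos.ne'
  field_simp

lemma integral_excessShare_mul (hX : Measurable X) (j : Fin m) {ψ : (Fin m → ℝ) → ℝ}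
    (hψ : Measurable ψ) {B : ℝ} (hB : ∀ x, |ψ x| ≤ B) :
    ∫ ω, excessShare α lam e j (X ω) * ψ (X ω) ∂P =
      ∫ ω, rejShare α lam e j (X ω) * ψ (X ω) ∂P -
        ∫ ω, lowShare α lam e j (X ω) * ψ (X ω) ∂P := by
  have hint {D : (Fin m → ℝ) → ℝ} (hD : Measurable D) (hD01 : ∀ x, D x ∈ Set.Icc (0 : ℝ) 1) :
      Integrable (fun ω => D (X ω) * ψ (X ω)) P := by
    refine integrable_comp_of_abs_le (ψ := fun x => D x * ψ x) (hD.mul hψ) hX (B := B) fun x => ?_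
    rw [abs_mul, abs_of_nonneg (hD01 x).1]
    exact (mul_le_of_le_one_left (abs_nonneg _) (hD01 x).2).trans (hB x)
  simp only [excessShare, sub_mul]
  exact integral_sub (hint (measurable_rejShare he.measurable j) (rejShare_mem_Icc j))
    (hint (measurable_lowShare he.measurable j) (he.lowShare_mem_Icc j))

lemma integral_excessShare_mul_eq_zero (hX : IndepUniformCoord P X j) {ψ : (Fin m → ℝ) → ℝ}
    (hψ : Measurable ψ) {B : ℝ} (hB : ∀ x, |ψ x| ≤ B) (hinv : InvariantBelow lam ψ) :
    ∫ ω, excessShare α lam e j (X ω) * ψ (X ω) ∂P = 0 := by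
  rw [he.integral_excessShare_mul hX.measurable j hψ hB,
    he.integral_rejShare_mul hX hψ hB fun x hj => hinv x j (hj.trans (adaptiveThreshold_le x)),
    he.integral_lowShare_mul hX hψ hB hinv, sub_self]

lemma integral_excessShare (hX : IndepUniformCoord P X j) :
    ∫ ω, excessShare α lam e j (X ω) ∂P = 0 := by
  simpa using he.integral_excessShare_mul_eq_zero hX (ψ := fun _ => 1) measurable_const
    (fun _ => abs_one.le) fun _ _ _ => rfl

lemma abs_lowShare_le_one (j : Fin m) (x : Fin m → ℝ) : |lowShare α lam e j x| ≤ 1 :=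
  (abs_of_nonneg (he.lowShare_mem_Icc j x).1).trans_le (he.lowShare_mem_Icc j x).2

lemma integral_excessShare_mul_lowShare (hX : IndepUniformCoord P X j) (k : Fin m) :
    ∫ ω, excessShare α lam e j (X ω) * lowShare α lam e k (X ω) ∂P = 0 :=
  he.integral_excessShare_mul_eq_zero hX (measurable_lowShare he.measurable k)
    (he.abs_lowShare_le_one k) (he.invariantBelow_lowShare k)

-- Setting the `j`-th `p`-value to `0` removes the share of `j` from the integrand, up to the factor
-- `α / e`, which is invariant and hence orthogonal to the excess share of `k`.
lemma integral_rejShare_mul_excessShare (hkj : k ≠ j) (hXj : IndepUniformCoord P X j)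
    (hXk : IndepUniformCoord P X k) :
    ∫ ω, rejShare α lam e j (X ω) * excessShare α lam e k (X ω) ∂P = 0 := by
  rw [he.integral_rejShare_mul hXj (measurable_excessShare he.measurable k)
    (he.abs_excessShare_le_one k) fun x hj => he.excessShare_update_zero hj k]
  simp only [mul_comm (α / _)]
  refine he.integral_excessShare_mul_eq_zero (hXk.update_zero hkj) (ψ := fun x => α / e x)
    (measurable_const.div he.measurable) (B := 1) (fun x => ?_)
    fun x i hi => congrArg (α / ·) (he.invariantBelow x i hi)
  exact (abs_of_nonneg (he.div_estimator_mem_Icc x).1).trans_le (he.div_estimator_mem_Icc x).2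

lemma integral_excessShare_mul_excessShare (hkj : k ≠ j) (hXj : IndepUniformCoord P X j)
    (hXk : IndepUniformCoord P X k) :
    ∫ ω, excessShare α lam e j (X ω) * excessShare α lam e k (X ω) ∂P = 0 := by
  rw [he.integral_excessShare_mul hXj.measurable j (measurable_excessShare he.measurable k)
    (he.abs_excessShare_le_one k), he.integral_rejShare_mul_excessShare hkj hXj hXk]
  simp only [mul_comm (lowShare α lam e j _), he.integral_excessShare_mul_lowShare hXk, sub_zero]

lemma integral_excessShare_sq (hX : IndepUniformCoord P X j) :
    ∫ ω, excessShare α lam e j (X ω) ^ 2 ∂P =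
      ∫ ω, rejShare α lam e j (X ω) ^ 2 ∂P - ∫ ω, lowShare α lam e j (X ω) ^ 2 ∂P := by
  have hsplit := he.integral_excessShare_mul (P := P) hX.measurable j
    (measurable_lowShare he.measurable j) (he.abs_lowShare_le_one j)
  rw [he.integral_excessShare_mul_lowShare hX] at hsplit
  simp only [pow_two]
  rw [he.integral_excessShare_mul hX.measurable j (measurable_excessShare he.measurable j)
    (he.abs_excessShare_le_one j)]
  simp only [mul_comm _ (excessShare α lam e j _), he.integral_excessShare_mul_lowShare hX]
  rw [he.integral_excessShare_mul hX.measurable j (measurable_rejShare he.measurable j)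
    (abs_rejShare_le_one j)]
  simp only [mul_comm (rejShare α lam e j _) (lowShare α lam e j _)] at hsplit
  linarith

lemma variance_sum_excessShare {I : Finset (Fin m)} (hX : ∀ j ∈ I, IndepUniformCoord P X j) :
    Var[fun ω => ∑ j ∈ I, excessShare α lam e j (X ω); P] = ∑ j ∈ I,
      (∫ ω, rejShare α lam e j (X ω) ^ 2 ∂P - ∫ ω, lowShare α lam e j (X ω) ^ 2 ∂P) := by
  have hmemLp (j : Fin m) (hj : j ∈ I) : MemLp (fun ω => excessShare α lam e j (X ω)) 2 P :=
    memLp_comp_of_abs_le (measurable_excessShare he.measurable j) (hX j hj).measurable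
      (he.abs_excessShare_le_one j) 2
  rw [variance_fun_sum' hmemLp]
  refine Finset.sum_congr rfl fun j hj => ?_
  have hcov (k : Fin m) (hk : k ∈ I) :
      cov[fun ω => excessShare α lam e j (X ω), fun ω => excessShare α lam e k (X ω); P] =
        ∫ ω, excessShare α lam e j (X ω) * excessShare α lam e k (X ω) ∂P := by
    rw [covariance_eq_sub (hmemLp j hj) (hmemLp k hk), he.integral_excessShare (hX j hj),
      zero_mul, sub_zero]
    rfl
  rw [Finset.sum_eq_single_of_mem j hj fun k hk hkj => by
      rw [hcov k hk, he.integral_excessShare_mul_excessShare hkj (hX j hj) (hX k hk)],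
    hcov j hj, ← he.integral_excessShare_sq (hX j hj)]
  simp only [pow_two]

lemma integral_rejShare_sq (hX : IndepUniformCoord P X j) :
    ∫ ω, rejShare α lam e j (X ω) ^ 2 ∂P = ∫ ω, α / e (Function.update (X ω) j 0) *
      (adaptiveR α lam e (Function.update (X ω) j 0) : ℝ)⁻¹ ∂P := by
  simp only [pow_two]
  rw [he.integral_rejShare_mul hX (measurable_rejShare he.measurable j) (abs_rejShare_le_one j)
    fun x hj => he.rejShare_update_zero hj j]
  simp only [he.rejShare_self_update_zero]

lemma integral_rejShare_sq_le {lam' : ℝ} (hf : Admissible α lam' f)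
    {d : ℝ} (hd : 0 < d) (hdf : ∀ x, d * f x ≤ e x)
    (hR : ∀ x, adaptiveR α lam' f x ≤ adaptiveR α lam e x) (hX : IndepUniformCoord P X j) :
    ∫ ω, rejShare α lam e j (X ω) ^ 2 ∂P ≤ d⁻¹ * ∫ ω, rejShare α lam' f j (X ω) ^ 2 ∂P := by
  have hint {lam : ℝ} {e : (Fin m → ℝ) → ℝ} (he : Admissible α lam e) :
      Integrable (fun ω => α / e (Function.update (X ω) j 0) *
        (adaptiveR α lam e (Function.update (X ω) j 0) : ℝ)⁻¹) P := by
    refine integrable_comp_of_abs_le (ψ := fun y => α / e y * (adaptiveR α lam e y : ℝ)⁻¹)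
      ((measurable_const.div he.measurable).mul
        (measurable_from_nat.comp (measurable_adaptiveR he.measurable)).inv)
      (measurable_update_left.comp hX.measurable) (B := 1) fun y => ?_
    have hα := he.div_estimator_mem_Icc y
    rw [abs_of_nonneg (mul_nonneg hα.1 (by positivity))]
    exact mul_le_one₀ hα.2 (by positivity) (Nat.cast_inv_le_one _)
  rw [he.integral_rejShare_sq hX, hf.integral_rejShare_sq hX, ← integral_const_mul]
  refine integral_mono (hint he) ((hint hf).const_mul _) fun ω => ?_
  set y := Function.update (X ω) j 0
  have hRpos : (0 : ℝ) < adaptiveR α lam' f y :=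
    Nat.cast_pos.2 (hf.one_le_adaptiveR_update_zero (X ω) j)
  have hquot : α / e y ≤ d⁻¹ * (α / f y) := by
    rw [inv_mul_eq_div, div_div, mul_comm (f y)]
    exact div_le_div_of_nonneg_left he.level_pos.le (mul_pos hd (hf.pos y)) (hdf y)
  calc α / e y * (adaptiveR α lam e y : ℝ)⁻¹
      ≤ d⁻¹ * (α / f y) * (adaptiveR α lam' f y : ℝ)⁻¹ := by
        gcongr
        · exact mul_nonneg (inv_nonneg.2 hd.le) (hf.div_estimator_mem_Icc y).1
        · exact_mod_cast hR y
    _ = d⁻¹ * (α / f y * (adaptiveR α lam' f y : ℝ)⁻¹) := mul_assoc _ _ _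

lemma adaptiveR_const_le (hαlam : α ≤ lam) {x : Fin m → ℝ} (hem : e x ≤ m) :
    adaptiveR α 1 (fun _ => (m : ℝ)) x ≤ adaptiveR α lam e x :=
  stepUpR_mono_crit fun i hi => by
    rw [← critBH_eq_critAdaptive he.level_pos.le (hαlam.trans he.threshold_le_one) hi,
      critBH_eq_critAdaptive he.level_pos.le hαlam hi]
    exact critAdaptive_anti he.level_pos.le (he.pos x) hem i

end Admissible

lemma sum_integral_rejShare_const_sq_le (hα : 0 < α) (hα1 : α ≤ 1) (hm : 1 ≤ m)
    {I : Finset (Fin m)} (hX : ∀ j ∈ I, IndepUniformCoord P X j) (hX1 : ∀ ω j, X ω j ≤ 1) :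
    ∑ j ∈ I, ∫ ω, rejShare α 1 (fun _ => (m : ℝ)) j (X ω) ^ 2 ∂P ≤
      Var[fun ω => FDP (critBH α m) I (X ω); P] + (m : ℝ)⁻¹ := by
  have hadm : Admissible α 1 fun _ : Fin m → ℝ => (m : ℝ) := admissible_const hα hα1 hm
  have hlow (j : Fin m) (ω : Ω) : lowShare α 1 (fun _ => (m : ℝ)) j (X ω) = α / m := by
    rw [lowShare, if_pos (hX1 ω j), one_mul]
  have hFDP (ω : Ω) : FDP (critBH α m) I (X ω) =
      ∑ j ∈ I, excessShare α 1 (fun _ => (m : ℝ)) j (X ω) + I.card * (α / m) := by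
    rw [FDP_critBH_eq_sum_rejShare hα.le hα1]
    simp only [excessShare, hlow, Finset.sum_sub_distrib, Finset.sum_const, nsmul_eq_mul,
      sub_add_cancel]
  have hmeas : Measurable fun ω => ∑ j ∈ I, excessShare α 1 (fun _ => (m : ℝ)) j (X ω) :=
    Finset.measurable_sum _ fun j hj =>
      (measurable_excessShare hadm.measurable j).comp (hX j hj).measurable
  have hvar : Var[fun ω => FDP (critBH α m) I (X ω); P] =
      ∑ j ∈ I, ∫ ω, rejShare α 1 (fun _ => (m : ℝ)) j (X ω) ^ 2 ∂P - I.card * (α / m) ^ 2 := by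
    simp only [hFDP]
    rw [variance_add_const hmeas.aestronglyMeasurable, hadm.variance_sum_excessShare hX]
    simp only [hlow, integral_const, probReal_univ, one_smul, Finset.sum_sub_distrib,
      Finset.sum_const, nsmul_eq_mul]
  have hcard : (I.card : ℝ) * (α / m) ^ 2 ≤ (m : ℝ)⁻¹ := by
    have hI : (I.card : ℝ) ≤ m := by exact_mod_cast I.card_le_univ.trans_eq (Fintype.card_fin m)
    calc (I.card : ℝ) * (α / m) ^ 2 ≤ m * (1 / m) ^ 2 := by gcongr
      _ = (m : ℝ)⁻¹ := by field_simp
  linarith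

lemma Admissible.variance_sum_excessShare_le (he : Admissible α lam e) (hαlam : α ≤ lam) {d : ℝ}
    (hd : 0 < d) (hde : ∀ x, d * m ≤ e x) (hem : ∀ x, e x ≤ m) (hm : 1 ≤ m)
    {I : Finset (Fin m)} (hX : ∀ j ∈ I, IndepUniformCoord P X j) (hX1 : ∀ ω j, X ω j ≤ 1) :
    Var[fun ω => ∑ j ∈ I, excessShare α lam e j (X ω); P] ≤
      d⁻¹ * (Var[fun ω => FDP (critBH α m) I (X ω); P] + (m : ℝ)⁻¹) := by
  have hα1 : α ≤ 1 := hαlam.trans he.threshold_le_one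
  rw [he.variance_sum_excessShare hX]
  calc ∑ j ∈ I, (∫ ω, rejShare α lam e j (X ω) ^ 2 ∂P - ∫ ω, lowShare α lam e j (X ω) ^ 2 ∂P)
      ≤ ∑ j ∈ I, ∫ ω, rejShare α lam e j (X ω) ^ 2 ∂P :=
        Finset.sum_le_sum fun j _ => sub_le_self _ (integral_nonneg fun _ => sq_nonneg _)
    _ ≤ ∑ j ∈ I, d⁻¹ * ∫ ω, rejShare α 1 (fun _ => (m : ℝ)) j (X ω) ^ 2 ∂P :=
        Finset.sum_le_sum fun j hj =>
          he.integral_rejShare_sq_le (admissible_const he.level_pos hα1 hm) hd hde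
            (fun x => he.adaptiveR_const_le hαlam (hem x)) (hX j hj)
    _ ≤ d⁻¹ * (Var[fun ω => FDP (critBH α m) I (X ω); P] + (m : ℝ)⁻¹) := by
        rw [← Finset.mul_sum]
        gcongr
        exact sum_integral_rejShare_const_sq_le he.level_pos hα1 hm hX hX1

end Moments

section InProbability

variable {Ω : ℕ → Type*} [∀ m, MeasurableSpace (Ω m)] {P : ∀ m, Measure (Ω m)}
  {X Y : ∀ m, Ω m → ℝ} {c d : ℝ}

lemma tendsto_measure_zero_of_subset_union {s t u : ∀ m, Set (Ω m)}
    (h : ∀ᶠ m in atTop, s m ⊆ t m ∪ u m) (ht : Tendsto (fun m => P m (t m)) atTop (𝓝 0))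
    (hu : Tendsto (fun m => P m (u m)) atTop (𝓝 0)) :
    Tendsto (fun m => P m (s m)) atTop (𝓝 0) := by
  refine tendsto_of_tendsto_of_tendsto_of_le_of_le' tendsto_const_nhds
    (by simpa using ht.add hu) (Eventually.of_forall fun _ => zero_le) ?_
  filter_upwards [h] with m hm
  exact (measure_mono hm).trans (measure_union_le _ _)

lemma tendsto_measure_compl_zero [∀ m, IsProbabilityMeasure (P m)] {s : ∀ m, Set (Ω m)}
    (hs : ∀ᶠ m in atTop, MeasurableSet (s m)) (h : Tendsto (fun m => P m (s m)) atTop (𝓝 1)) :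
    Tendsto (fun m => P m (s m)ᶜ) atTop (𝓝 0) := by
  have hsub : Tendsto (fun m => 1 - P m (s m)) atTop (𝓝 (1 - 1)) :=
    ENNReal.Tendsto.sub tendsto_const_nhds h (Or.inl ENNReal.one_ne_top)
  rw [tsub_self] at hsub
  refine hsub.congr' ?_
  filter_upwards [hs] with m hm using (prob_compl_eq_one_sub hm).symm

lemma tendsto_measure_one_of_subset [∀ m, IsProbabilityMeasure (P m)] {s t : ∀ m, Set (Ω m)}
    (h : ∀ m, s m ⊆ t m) (hs : Tendsto (fun m => P m (s m)) atTop (𝓝 1)) :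
    Tendsto (fun m => P m (t m)) atTop (𝓝 1) :=
  tendsto_of_tendsto_of_tendsto_of_le_of_le hs tendsto_const_nhds (fun m => measure_mono (h m))
    fun _ => prob_le_one

lemma tendstoInProb_of_tendsto {a : ℕ → ℝ} (ha : Tendsto a atTop (𝓝 c)) :
    TendstoInProb P (fun m _ => a m) c := fun ε hε => by
  refine tendsto_const_nhds.congr' ?_
  filter_upwards [ha (Metric.ball_mem_nhds c hε)] with m hm
  have hlt : |a m - c| < ε := hm
  simp [hlt.not_ge]

namespace TendstoInProb

lemma congr_of_ne (hX : TendstoInProb P X c) {s : ∀ m, Set (Ω m)}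
    (hXY : ∀ m ω, X m ω ≠ Y m ω → ω ∈ s m) (hs : Tendsto (fun m => P m (s m)) atTop (𝓝 0)) :
    TendstoInProb P Y c := fun ε hε =>
  tendsto_measure_zero_of_subset_union (Eventually.of_forall fun m ω hω =>
    or_iff_not_imp_right.2 fun h => by
      rwa [Set.mem_ofPred_eq, not_not.1 (mt (hXY m ω) h)]) (hX ε hε) hs

lemma comp₂ (hX : TendstoInProb P X c) (hY : TendstoInProb P Y d) {F : ℝ × ℝ → ℝ}
    (hF : ContinuousAt F (c, d)) : TendstoInProb P (fun m ω => F (X m ω, Y m ω)) (F (c, d)) := by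
  intro ε hε
  obtain ⟨δ, hδ, hFδ⟩ := Metric.continuousAt_iff.1 hF ε hε
  refine tendsto_measure_zero_of_subset_union (Eventually.of_forall fun m ω hω => ?_)
    (hX δ hδ) (hY δ hδ)
  by_contra hclose
  simp only [Set.mem_union, Set.mem_ofPred_eq, not_or, not_le] at hclose
  exact (hFδ (x := (X m ω, Y m ω)) (max_lt hclose.1 hclose.2)).not_ge hω

lemma add (hX : TendstoInProb P X c) (hY : TendstoInProb P Y d) :
    TendstoInProb P (fun m ω => X m ω + Y m ω) (c + d) :=
  hX.comp₂ hY (F := fun z => z.1 + z.2) continuous_add.continuousAt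

end TendstoInProb

lemma Consistent.tendstoInProb (hX : Consistent P X)
    (hmean : Tendsto (fun m => ∫ ω, X m ω ∂(P m)) atTop (𝓝 c)) : TendstoInProb P X c := by
  simpa only [sub_add_cancel, zero_add] using hX.add (tendstoInProb_of_tendsto hmean)

lemma integral_le_add_mul_measureReal {Ω : Type*} [MeasurableSpace Ω] {P : Measure Ω}
    [IsProbabilityMeasure P] {Y : Ω → ℝ} (hY : Measurable Y) (hint : Integrable Y P) {B ε : ℝ}
    (hB : ∀ ω, Y ω ≤ B) (hε : 0 ≤ ε) : ∫ ω, Y ω ∂P ≤ ε + B * P.real {ω | ε ≤ Y ω} := by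
  have hs : MeasurableSet {ω | ε ≤ Y ω} := measurableSet_le measurable_const hY
  have hsint : Integrable ({ω | ε ≤ Y ω}.indicator fun _ => B) P :=
    (integrable_const B).indicator hs
  calc ∫ ω, Y ω ∂P ≤ ∫ ω, (ε + {ω | ε ≤ Y ω}.indicator (fun _ => B) ω) ∂P := by
        refine integral_mono hint ((integrable_const ε).add hsint) fun ω => ?_
        by_cases hω : ω ∈ {ω | ε ≤ Y ω}
        · rw [Set.indicator_of_mem hω]
          exact (hB ω).trans (le_add_of_nonneg_left hε)
        · rw [Set.indicator_of_notMem hω, add_zero]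
          exact (not_le.1 hω).le
    _ = ε + B * P.real {ω | ε ≤ Y ω} := by
        rw [integral_add (integrable_const ε) hsint, integral_indicator_const B hs]
        simp [mul_comm]

variable [∀ m, IsProbabilityMeasure (P m)]

lemma TendstoInProb.tendsto_integral_abs_sub (hX : TendstoInProb P X c)
    (hmeas : ∀ᶠ m in atTop, Measurable (X m)) {B : ℝ}
    (hB : ∀ᶠ m in atTop, ∀ ω, |X m ω - c| ≤ B) :
    Tendsto (fun m => ∫ ω, |X m ω - c| ∂(P m)) atTop (𝓝 0) := by
  refine tendsto_order.2 ⟨fun a ha => Eventually.of_forall fun m =>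
    ha.trans_le (integral_nonneg fun _ => abs_nonneg _), fun ε hε => ?_⟩
  have hbound : Tendsto (fun m => ε / 2 + B * (P m).real {ω | ε / 2 ≤ |X m ω - c|}) atTop
      (𝓝 (ε / 2)) := by
    have h := (ENNReal.tendsto_toReal ENNReal.zero_ne_top).comp (hX (ε / 2) (half_pos hε))
    simpa [Measure.real, Function.comp_def] using (h.const_mul B).const_add (ε / 2)
  filter_upwards [hmeas, hB, hbound.eventually_lt_const (half_lt_self hε)] with m hmeas hB hlt
  have habs : Measurable fun ω => |X m ω - c| := (hmeas.sub_const c).abs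
  exact (integral_le_add_mul_measureReal habs
    (Integrable.of_bound habs.aestronglyMeasurable B
      (ae_of_all _ fun ω => by simpa using hB ω)) hB (half_pos hε).le).trans_lt hlt

lemma TendstoInProb.consistent (hX : TendstoInProb P X c)
    (hmeas : ∀ᶠ m in atTop, Measurable (X m))
    (h01 : ∀ᶠ m in atTop, ∀ ω, X m ω ∈ Set.Icc (0 : ℝ) 1) : Consistent P X := by
  have hdev : Tendsto (fun m => ∫ ω, |X m ω - c| ∂(P m)) atTop (𝓝 0) := by
    refine hX.tendsto_integral_abs_sub hmeas (B := 1 + |c|) ?_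
    filter_upwards [h01] with m h01 ω
    exact (abs_sub _ _).trans (by gcongr; exact abs_le.2 ⟨by linarith [(h01 ω).1], (h01 ω).2⟩)
  have hmean : Tendsto (fun m => -∫ ω, X m ω ∂(P m)) atTop (𝓝 (-c)) := by
    refine (tendsto_iff_norm_sub_tendsto_zero.2 (squeeze_zero' ?_ ?_ hdev)).neg
    · exact Eventually.of_forall fun m => norm_nonneg _
    · filter_upwards [hmeas, h01] with m hmeas h01
      have hint : Integrable (X m) (P m) :=
        Integrable.of_mem_Icc 0 1 hmeas.aemeasurable (ae_of_all _ h01)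
      calc ‖∫ ω, X m ω ∂(P m) - c‖ = ‖∫ ω, (X m ω - c) ∂(P m)‖ := by
            rw [integral_sub hint (integrable_const _), integral_const, probReal_univ, one_smul]
        _ ≤ ∫ ω, |X m ω - c| ∂(P m) := norm_integral_le_integral_norm _
  simpa only [Consistent, sub_eq_add_neg, add_neg_cancel] using
    hX.add (tendstoInProb_of_tendsto hmean)

namespace Consistent

lemma of_tendsto_variance (hX : ∀ᶠ m in atTop, MemLp (X m) 2 (P m))
    (hvar : Tendsto (fun m => Var[X m; P m]) atTop (𝓝 0)) : Consistent P X := fun ε hε => by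
  have hbound : Tendsto (fun m => ENNReal.ofReal (Var[X m; P m] / ε ^ 2)) atTop (𝓝 0) := by
    simpa using ENNReal.tendsto_ofReal (hvar.div_const (ε ^ 2))
  refine tendsto_of_tendsto_of_tendsto_of_le_of_le' tendsto_const_nhds hbound
    (Eventually.of_forall fun _ => zero_le) ?_
  filter_upwards [hX] with m hX
  simpa only [sub_zero] using meas_ge_le_variance_div_sq hX hε

lemma tendsto_variance (hX : Consistent P X) (hmeas : ∀ᶠ m in atTop, Measurable (X m))
    (h01 : ∀ᶠ m in atTop, ∀ ω, X m ω ∈ Set.Icc (0 : ℝ) 1) :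
    Tendsto (fun m => Var[X m; P m]) atTop (𝓝 0) := by
  have hdev : ∀ᶠ m in atTop, ∀ ω, |X m ω - ∫ ω', X m ω' ∂(P m)| ≤ 1 := by
    filter_upwards [hmeas, h01] with m hmeas h01 ω
    have hint : Integrable (X m) (P m) :=
        Integrable.of_mem_Icc 0 1 hmeas.aemeasurable (ae_of_all _ h01)
    refine abs_sub_le_of_nonneg_of_le (h01 ω).1 (h01 ω).2 (integral_nonneg fun ω => (h01 ω).1) ?_
    simpa using integral_mono hint (integrable_const (1 : ℝ)) fun ω => (h01 ω).2
  have habs : Tendsto (fun m => ∫ ω, |X m ω - ∫ ω', X m ω' ∂(P m)| ∂(P m)) atTop (𝓝 0) := by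
    simpa only [sub_zero] using TendstoInProb.tendsto_integral_abs_sub hX
      (hmeas.mono fun m hmeas => hmeas.sub_const _) (by simpa only [sub_zero] using hdev)
  refine squeeze_zero' (Eventually.of_forall fun m => variance_nonneg _ _) ?_ habs
  filter_upwards [hmeas, hdev] with m hmeas hdev
  rw [variance_eq_integral hmeas.aemeasurable]
  have hmeas' : Measurable fun ω => |X m ω - ∫ ω', X m ω' ∂(P m)| := (hmeas.sub_const _).abs
  refine integral_mono_of_nonneg (ae_of_all _ fun ω => sq_nonneg _)
    (Integrable.of_bound hmeas'.aestronglyMeasurable 1 (ae_of_all _ fun ω => by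
      simpa using hdev ω)) (ae_of_all _ fun ω => ?_)
  simpa only [sq_abs] using pow_le_of_le_one (abs_nonneg _) (hdev ω) two_ne_zero

end Consistent

end InProbability

section TrueNullCount

variable {Ω : Type*} [MeasurableSpace Ω] {P : Measure Ω} {m : ℕ} {I : Finset (Fin m)}
  {p : Fin m → Ω → ℝ} (h : BasicIndependence P I p)
include h

namespace BasicIndependence

lemma measurable_ite_le (j : Fin m) (t : ℝ) :
    Measurable fun ω => if p j ω ≤ t then (1 : ℝ) else 0 :=
  Measurable.ite (measurableSet_le (h.measurable j) measurable_const) measurable_const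
    measurable_const

variable [IsProbabilityMeasure P]

lemma memLp_ite_le (j : Fin m) (t : ℝ) :
    MemLp (fun ω => if p j ω ≤ t then (1 : ℝ) else 0) 2 P :=
  MemLp.of_bound (h.measurable_ite_le j t).aestronglyMeasurable 1
    (ae_of_all _ fun ω => by split_ifs <;> simp)

lemma memLp_card_filter_le (t : ℝ) :
    MemLp (fun ω => ((I.filter fun j => p j ω ≤ t).card : ℝ)) 2 P := by
  simp only [Finset.natCast_card_filter]
  exact memLp_finsetSum _ fun j _ => h.memLp_ite_le j t

lemma integral_card_filter_le {t : ℝ} (ht : t ∈ Set.Icc (0 : ℝ) 1) :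
    ∫ ω, ((I.filter fun j => p j ω ≤ t).card : ℝ) ∂P = I.card * t := by
  simp only [Finset.natCast_card_filter]
  rw [integral_finsetSum _ fun j _ => (h.memLp_ite_le j t).integrable one_le_two,
    Finset.sum_congr rfl fun j hj => ?_, Finset.sum_const, nsmul_eq_mul]
  calc ∫ ω, (if p j ω ≤ t then (1 : ℝ) else 0) ∂P
      = ∫ ω, {ω | p j ω ≤ t}.indicator 1 ω ∂P := rfl
    _ = P.real {ω | p j ω ≤ t} :=
        integral_indicator_one (measurableSet_le (h.measurable j) measurable_const)
    _ = t := (congrArg ENNReal.toReal (h.uniform j hj t ht)).trans (ENNReal.toReal_ofReal ht.1)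

lemma variance_card_filter_le (t : ℝ) :
    Var[fun ω => ((I.filter fun j => p j ω ≤ t).card : ℝ); P] ≤ I.card := by
  have hindep : (I : Set (Fin m)).Pairwise fun j k =>
      IndepFun (fun ω => if p j ω ≤ t then (1 : ℝ) else 0)
        (fun ω => if p k ω ≤ t then (1 : ℝ) else 0) P := fun j hj k hk hjk => by
    have hite : Measurable fun u : ℝ => if u ≤ t then (1 : ℝ) else 0 :=
      Measurable.ite measurableSet_Iic measurable_const measurable_const
    exact (h.indep_true.indepFun (i := ⟨j, hj⟩) (j := ⟨k, hk⟩) (by simpa using hjk)).comp hite hite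
  have hone (j : Fin m) : Var[fun ω => if p j ω ≤ t then (1 : ℝ) else 0; P] ≤ 1 :=
    (variance_le_sq_of_bounded (a := 0) (b := 1) (ae_of_all _ fun ω => by split_ifs <;> simp)
      (h.measurable_ite_le j t).aemeasurable).trans (by norm_num)
  simp only [Finset.natCast_card_filter]
  rw [← Finset.sum_fn, IndepFun.variance_sum (fun j _ => h.memLp_ite_le j t) hindep]
  simpa using Finset.sum_le_sum fun j (_ : j ∈ I) => hone j

end BasicIndependence

end TrueNullCount

section Limit

variable {Ω : ℕ → Type*} [∀ m, MeasurableSpace (Ω m)] {P : ∀ m, Measure (Ω m)}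
  [∀ m, IsProbabilityMeasure (P m)] {I : ∀ m, Finset (Fin m)} {p : ∀ m, Fin m → Ω m → ℝ}

lemma tendstoInProb_card_filter_le_div
    (hp : ∀ᶠ m in atTop, BasicIndependence (P m) (I m) (p m)) {κ : ℝ}
    (hκ : Tendsto (fun m : ℕ => ((I m).card : ℝ) / m) atTop (𝓝 κ)) {t : ℝ}
    (ht : t ∈ Set.Icc (0 : ℝ) 1) :
    TendstoInProb P (fun m ω => (((I m).filter fun j => p m j ω ≤ t).card : ℝ) / m) (κ * t) := by
  simp only [div_eq_inv_mul] at hκ ⊢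
  refine (Consistent.of_tendsto_variance ?_ ?_).tendstoInProb ?_
  · filter_upwards [hp] with m hp using (hp.memLp_card_filter_le t).const_mul _
  · refine squeeze_zero' (Eventually.of_forall fun m => variance_nonneg _ _) ?_
      tendsto_inv_atTop_nhds_zero_nat
    filter_upwards [hp, eventually_ge_atTop 1] with m hp hm
    have hcard : ((I m).card : ℝ) ≤ m := by
      exact_mod_cast (I m).card_le_univ.trans_eq (Fintype.card_fin m)
    rw [variance_const_mul]
    calc ((m : ℝ)⁻¹) ^ 2 * Var[fun ω => (((I m).filter fun j => p m j ω ≤ t).card : ℝ); P m]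
        ≤ ((m : ℝ)⁻¹) ^ 2 * m := by gcongr; exact (hp.variance_card_filter_le t).trans hcard
      _ = (m : ℝ)⁻¹ := by field_simp
  · refine (hκ.mul_const t).congr' ?_
    filter_upwards [hp] with m hp
    rw [integral_const_mul, hp.integral_card_filter_le ht, mul_assoc]

variable {α lam : ℝ} {e : ∀ m, (Fin m → ℝ) → ℝ}

lemma measurable_FDP_critAdaptive {m : ℕ} {e : (Fin m → ℝ) → ℝ} (he : Measurable e)
    (I : Finset (Fin m)) : Measurable fun x => FDP (critAdaptive α lam (e x)) I x := by
  simp only [FDP_eq_sum_rejShare]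
  exact Finset.measurable_sum _ fun j _ => measurable_rejShare he j

lemma measurable_FDP_critBH {m : ℕ} (hα : 0 ≤ α) (hα1 : α ≤ 1) (I : Finset (Fin m)) :
    Measurable fun x => FDP (critBH α m) I x := by
  simp only [FDP_critBH_eq_sum_rejShare hα hα1]
  exact Finset.measurable_sum _ fun j _ => measurable_rejShare measurable_const j

lemma tendstoInProb_sum_excessShare
    (hp : ∀ᶠ m in atTop, BasicIndependence (P m) (I m) (p m))
    (he : ∀ᶠ m in atTop, Admissible α lam (e m)) (hαlam : α ≤ lam) {d : ℝ} (hd : 0 < d)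
    (hde : ∀ᶠ m : ℕ in atTop, ∀ x, e m x ∈ Set.Icc (d * m) m)
    (hBH : Consistent P fun m ω => FDP (critBH α m) (I m) fun i => p m i ω) :
    TendstoInProb P (fun m ω => ∑ j ∈ I m, excessShare α lam (e m) j fun i => p m i ω) 0 := by
  have hBHvar : Tendsto (fun m => Var[fun ω => FDP (critBH α m) (I m) fun i => p m i ω; P m])
      atTop (𝓝 0) := by
    refine hBH.tendsto_variance ?_ ?_
    · filter_upwards [hp, he] with m hp he
      exact (measurable_FDP_critBH he.level_pos.le (hαlam.trans he.threshold_le_one) (I m)).comp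
        hp.measurable_pi
    · filter_upwards [he] with m he ω using FDP_mem_Icc (critBH_mono he.level_pos.le m) _ _
  have hbound : Tendsto (fun m : ℕ => d⁻¹ *
      (Var[fun ω => FDP (critBH α m) (I m) fun i => p m i ω; P m] + (m : ℝ)⁻¹)) atTop (𝓝 0) := by
    simpa using (hBHvar.add tendsto_inv_atTop_nhds_zero_nat).const_mul d⁻¹
  refine (Consistent.of_tendsto_variance ?_ (squeeze_zero'
    (Eventually.of_forall fun m => variance_nonneg _ _) ?_ hbound)).tendstoInProb
    (tendsto_const_nhds.congr' ?_)
  · filter_upwards [hp, he] with m hp he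
    exact memLp_finsetSum _ fun j _ => memLp_comp_of_abs_le
      (measurable_excessShare he.measurable j) hp.measurable_pi (he.abs_excessShare_le_one j) 2
  · filter_upwards [hp, he, hde, eventually_ge_atTop 1] with m hp he hde hm
    exact he.variance_sum_excessShare_le hαlam hd (fun x => (hde x).1) (fun x => (hde x).2) hm
      (fun j hj => hp.indepUniformCoord hj) fun ω j => (hp.mem_Icc j ω).2
  · filter_upwards [hp, he] with m hp he
    rw [integral_finsetSum _ fun j _ => integrable_comp_of_abs_le
      (measurable_excessShare he.measurable j) hp.measurable_pi (he.abs_excessShare_le_one j)]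
    exact (Finset.sum_eq_zero fun j hj => he.integral_excessShare (hp.indepUniformCoord hj)).symm

lemma tendstoInProb_FDP_critAdaptive
    (hp : ∀ᶠ m in atTop, BasicIndependence (P m) (I m) (p m)) {κ : ℝ}
    (hκ : Tendsto (fun m : ℕ => ((I m).card : ℝ) / m) atTop (𝓝 κ))
    (he : ∀ᶠ m in atTop, Admissible α lam (e m)) (hαlam : α ≤ lam) {d : ℝ} (hd : 0 < d)
    (hde : ∀ᶠ m : ℕ in atTop, ∀ x, e m x ∈ Set.Icc (d * m) m) {C : ℝ} (hC : C ≠ 0)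
    (hlim : TendstoInProb P (fun m ω => e m (fun i => p m i ω) / m) C)
    (hBH : Consistent P fun m ω => FDP (critBH α m) (I m) fun i => p m i ω) :
    TendstoInProb P (fun m ω => FDP (critAdaptive α lam (e m fun i => p m i ω)) (I m)
      fun i => p m i ω) (κ * lam * (α / (lam * C))) := by
  obtain ⟨m, hem⟩ := he.exists
  have hcond := (tendstoInProb_card_filter_le_div hp hκ
    ⟨hem.threshold_pos.le, hem.threshold_le_one⟩).comp₂ hlim
    (F := fun z => z.1 * (α / (lam * z.2))) (by
      have : lam * C ≠ 0 := mul_ne_zero hem.threshold_pos.ne' hC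
      fun_prop (disch := assumption))
  have hrescale (m : ℕ) (ω : Ω m) :
      (((I m).filter fun j => p m j ω ≤ lam).card : ℝ) / m *
        (α / (lam * (e m (fun i => p m i ω) / m))) =
      (((I m).filter fun j => p m j ω ≤ lam).card : ℝ) *
        (α / (lam * e m fun i => p m i ω)) := by
    rcases Nat.eq_zero_or_pos m with rfl | hm
    · simp [Finset.eq_empty_of_isEmpty]
    · field_simp
  simpa only [hrescale, ← FDP_eq_sum_excessShare_add, zero_add] using
    (tendstoInProb_sum_excessShare hp he hαlam hd hde hBH).add hcond

end Limit

section Clamp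

variable {m : ℕ} {α lam d : ℝ} {e : (Fin m → ℝ) → ℝ}

/-- The modification of the estimator `e` which enforces the bounds that `e` is only assumed to
satisfy with probability tending to one. -/
noncomputable def clampEstimator (α lam d : ℝ) (e : (Fin m → ℝ) → ℝ) (x : Fin m → ℝ) : ℝ :=
  min (max (e x) (max (α / lam * max (countLE x lam : ℝ) 1) (d * m))) m

lemma clampEstimator_mem_Icc (hd : d ≤ 1) (x : Fin m → ℝ) :
    clampEstimator α lam d e x ∈ Set.Icc (d * m) m :=
  ⟨le_min ((le_max_right _ _).trans (le_max_right _ _))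
    (mul_le_of_le_one_left (Nat.cast_nonneg m) hd), min_le_right _ _⟩

lemma clampEstimator_eq {x : Fin m → ℝ} (hcount : α / lam * max (countLE x lam : ℝ) 1 ≤ e x)
    (hd : d * m ≤ e x) (hm : e x ≤ m) : clampEstimator α lam d e x = e x := by
  rw [clampEstimator, max_eq_left (max_le hcount hd), min_eq_left hm]

lemma admissible_clampEstimator (hα : 0 < α) (hαlam : α ≤ lam) (hlam : lam ≤ 1) (hm : 1 ≤ m)
    (he : Measurable e) (hinv : InvariantBelow lam e) :
    Admissible α lam (clampEstimator α lam d e) where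
  level_pos := hα
  threshold_pos := hα.trans_le hαlam
  threshold_le_one := hlam
  measurable := by
    have hcount : Measurable fun x : Fin m → ℝ => (countLE x lam : ℝ) :=
      measurable_from_nat.comp (measurable_countLE_left lam)
    unfold clampEstimator
    fun_prop
  invariantBelow x j hj := by
    rw [clampEstimator, clampEstimator, hinv x j hj,
      countLE_update_zero x j (hα.le.trans hαlam) hj]
  le_estimator x := by
    refine le_min ((le_max_left _ _).trans (le_max_right _ _)) ?_
    have hcount : max (countLE x lam : ℝ) 1 ≤ m :=
      max_le (by exact_mod_cast countLE_le x lam) (by exact_mod_cast hm)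
    exact (mul_le_of_le_one_left (by positivity)
      (div_le_one_of_le₀ hαlam (hα.le.trans hαlam))).trans hcount

lemma measurable_estimate {g : (Set.Ici lam → ℝ) → ℝ} (hg : Measurable g) :
    Measurable (estimate (m := m) g) :=
  hg.comp (measurable_pi_iff.2 fun t =>
    (measurable_from_nat.comp (measurable_countLE_left (t : ℝ))).div_const _)

lemma invariantBelow_estimate (hlam : 0 ≤ lam) (g : (Set.Ici lam → ℝ) → ℝ) :
    InvariantBelow lam (estimate (m := m) g) := fun x j hj =>
  congrArg g <| funext fun t => by
    rw [ecdf, ecdf, countLE_update_zero x j (hlam.trans t.2) (hj.trans t.2)]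

end Clamp

lemma tendsto_measure_clampEstimator_ne {Ω : ℕ → Type*} [∀ m, MeasurableSpace (Ω m)]
    {P : ∀ m, Measure (Ω m)} [∀ m, IsProbabilityMeasure (P m)]
    {X : ∀ m, Ω m → Fin m → ℝ} (hX : ∀ᶠ m in atTop, Measurable (X m))
    {α lam : ℝ} {e : ∀ m, (Fin m → ℝ) → ℝ} (he : ∀ᶠ m in atTop, Measurable (e m))
    (hcount : Tendsto (fun m => P m {ω | α / lam * max (countLE (X m ω) lam : ℝ) 1 ≤ e m (X m ω)})
      atTop (𝓝 1)) {C : ℝ} (hC : C ∈ Set.Ioc (0 : ℝ) 1)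
    (hlim : TendstoInProb P (fun m ω => e m (X m ω) / m) C)
    (hCone : C = 1 → Tendsto (fun m : ℕ => P m {ω | e m (X m ω) / m ≤ 1}) atTop (𝓝 1)) :
    Tendsto (fun m => P m {ω | clampEstimator α lam (C / 2) (e m) (X m ω) ≠ e m (X m ω)}) atTop
      (𝓝 0) := by
  have hcount' : Tendsto (fun m =>
      P m {ω | α / lam * max (countLE (X m ω) lam : ℝ) 1 ≤ e m (X m ω)}ᶜ) atTop (𝓝 0) := by
    refine tendsto_measure_compl_zero ?_ hcount
    filter_upwards [hX, he] with m hX he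
    have hcountLE : Measurable fun ω => (countLE (X m ω) lam : ℝ) :=
      measurable_from_nat.comp ((measurable_countLE_left lam).comp hX)
    exact measurableSet_le (by fun_prop) (he.comp hX)
  have hle : Tendsto (fun m : ℕ => P m {ω | e m (X m ω) / m ≤ 1}ᶜ) atTop (𝓝 0) := by
    rcases hC.2.eq_or_lt with h1 | h1
    · refine tendsto_measure_compl_zero ?_ (hCone h1)
      filter_upwards [hX, he] with m hX he
      exact measurableSet_le ((he.comp hX).div_const _) measurable_const
    · refine tendsto_measure_zero_of_subset_union (u := fun _ => ∅)
        (Eventually.of_forall fun m ω hω => Or.inl ?_) (hlim (1 - C) (sub_pos.2 h1)) (by simp)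
      have hlt : 1 < e m (X m ω) / m := not_le.1 hω
      exact (sub_le_sub_right hlt.le C).trans (le_abs_self _)
  refine tendsto_measure_zero_of_subset_union ?_ hcount'
    (tendsto_measure_zero_of_subset_union (Eventually.of_forall fun m => subset_rfl)
      (hlim (C / 2) (half_pos hC.1)) hle)
  filter_upwards [eventually_gt_atTop 0] with m hm ω hω
  by_contra hgood
  simp only [Set.mem_union, Set.mem_compl_iff, Set.mem_ofPred_eq, not_or, not_not] at hgood
  obtain ⟨hcount, hclose, hle⟩ := hgood
  have hm0 : (0 : ℝ) < m := Nat.cast_pos.2 hm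
  refine hω (clampEstimator_eq hcount ?_ ((div_le_one hm0).1 hle))
  rw [← le_div_iff₀ hm0]
  linarith [(abs_lt.1 (not_le.1 hclose)).1]

end AdaptiveTest

theorem lemma5p4_general
    {Ω : ℕ → Type*} [∀ m, MeasurableSpace (Ω m)]
    (P : ∀ m, Measure (Ω m)) [∀ m, IsProbabilityMeasure (P m)]
    (I₀ : ∀ m, Finset (Fin m)) (p : ∀ m, Fin m → Ω m → ℝ)
    (hBI : ∀ m, 2 ≤ m → BasicIndependence (P m) (I₀ m) (p m))
    (α lam : ℝ) (hα : 0 < α) (hαlam : α ≤ lam) (hlam : lam ≤ 1)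
    (e : ∀ m, (Fin m → ℝ) → ℝ) (he : ∀ m, 2 ≤ m → Measurable (e m))
    (hinv : ∀ m, 2 ≤ m → InvariantBelow lam (e m))
    (hpos : ∀ m, 2 ≤ m → ∀ ω, 0 < e m (fun i => p m i ω))
    (κ₀ : ℝ) (hA1 : Tendsto (fun m : ℕ => ((I₀ m).card : ℝ) / m) atTop (𝓝 κ₀))
    (hA4 : Tendsto (fun m => P m {ω |
      α / lam * max (countLE (fun i => p m i ω) lam : ℝ) 1 ≤ e m (fun i => p m i ω)}) atTop (𝓝 1))
    (C₀ : ℝ) (hC₀ : C₀ ∈ Set.Ioc (0 : ℝ) 1)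
    (hlim : TendstoInProb P (fun m ω => e m (fun i => p m i ω) / m) C₀)
    (hC₀one : C₀ = 1 →
      Tendsto (fun m : ℕ => P m {ω | e m (fun i => p m i ω) / m ≤ 1}) atTop (𝓝 1))
    (hBH : Consistent P (fun m ω => FDP (critBH α m) (I₀ m) (fun i => p m i ω))) :
    Consistent P (fun m ω => FDP (critAdaptive α lam (e m (fun i => p m i ω)))
      (I₀ m) (fun i => p m i ω)) := by
  have hp : ∀ᶠ m in atTop, BasicIndependence (P m) (I₀ m) (p m) := eventually_atTop.2 ⟨2, hBI⟩
  have hem : ∀ᶠ m in atTop, Measurable (e m) := eventually_atTop.2 ⟨2, he⟩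
  have hne := tendsto_measure_clampEstimator_ne (hp.mono fun m hp => hp.measurable_pi) hem hA4 hC₀
    hlim hC₀one
  have hadm : ∀ᶠ m : ℕ in atTop, Admissible α lam (clampEstimator α lam (C₀ / 2) (e m)) :=
    eventually_atTop.2 ⟨2, fun m hm =>
      admissible_clampEstimator hα hαlam hlam (one_le_two.trans hm) (he m hm) (hinv m hm)⟩
  have hlim' : TendstoInProb P
      (fun m ω => clampEstimator α lam (C₀ / 2) (e m) (fun i => p m i ω) / m) C₀ :=
    hlim.congr_of_ne (fun _ _ => mt fun h => by rw [h]) hne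
  have hclamp : TendstoInProb P (fun m ω => FDP (critAdaptive α lam
      (clampEstimator α lam (C₀ / 2) (e m) fun i => p m i ω)) (I₀ m) fun i => p m i ω)
      (κ₀ * lam * (α / (lam * C₀))) :=
    tendstoInProb_FDP_critAdaptive hp hA1 hadm hαlam (half_pos hC₀.1)
      (Eventually.of_forall fun m => clampEstimator_mem_Icc ((half_le_self hC₀.1.le).trans hC₀.2))
      hC₀.1.ne' hlim' hBH
  have hFDP : TendstoInProb P (fun m ω => FDP (critAdaptive α lam (e m fun i => p m i ω)) (I₀ m)
      fun i => p m i ω) (κ₀ * lam * (α / (lam * C₀))) :=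
    hclamp.congr_of_ne (fun _ _ => mt fun h => by rw [h]) hne
  refine hFDP.consistent ?_ ?_
  · filter_upwards [hp, hem] with m hp hem using
      (measurable_FDP_critAdaptive hem (I₀ m)).comp hp.measurable_pi
  · filter_upwards [eventually_ge_atTop 2] with m hm ω using
      FDP_mem_Icc (critAdaptive_mono hα.le (hpos m hm ω).le) _ _

theorem lemma5p4
    {Ω : ℕ → Type*} [∀ m, MeasurableSpace (Ω m)]
    (P : ∀ m, Measure (Ω m)) [∀ m, IsProbabilityMeasure (P m)]
    -- the true nulls and the p-values of the m-th testing problem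
    (I₀ : ∀ m, Finset (Fin m)) (p : ∀ m, Fin m → Ω m → ℝ)
    (hBI : ∀ m, 2 ≤ m → BasicIndependence (P m) (I₀ m) (p m))
    -- the level and the tuning parameter
    (α lam : ℝ) (hα : 0 < α) (hαlam : α ≤ lam) (hlam : lam < 1)
    -- the estimators: positive measurable functions of the empirical distribution function
    -- on the region to the right of the tuning parameter
    (g : ∀ _ : ℕ, (Set.Ici lam → ℝ) → ℝ) (hg : ∀ m, 2 ≤ m → Measurable (g m))
    (hpos : ∀ m, 2 ≤ m → ∀ ω, 0 < estimate (g m) (fun i => p m i ω))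
    -- the proportion of true nulls converges to a positive limit
    (κ₀ : ℝ) (hκ₀ : κ₀ ∈ Set.Ioc (0 : ℝ) 1)
    (hA1 : Tendsto (fun m : ℕ => ((I₀ m).card : ℝ) / m) atTop (𝓝 κ₀))
    -- the estimator is at most of order m
    (hA3 : ∃ K : ℝ, 0 < K ∧ ∀ m, 2 ≤ m → ∀ ω, estimate (g m) (fun i => p m i ω) ≤ K * m)
    -- the estimator is not too small, with probability tending to one
    (hA4 : ∃ C : ℝ, 1 < C ∧ Tendsto (fun m => P m {ω |
      C * α / lam * max (countLE (fun i => p m i ω) lam : ℝ) 1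
        ≤ estimate (g m) (fun i => p m i ω)}) atTop (𝓝 1))
    (C₀ : ℝ) (hC₀ : C₀ ∈ Set.Icc (α * κ₀) 1)
    (hlim : TendstoInProb P (fun m ω => estimate (g m) (fun i => p m i ω) / m) C₀)
    (hC₀one : C₀ = 1 → Tendsto (fun m : ℕ =>
      P m {ω | estimate (g m) (fun i => p m i ω) / m ≤ 1}) atTop (𝓝 1))
    -- the Benjamini-Hochberg test is consistent
    (hBH : Consistent P (fun m ω => FDP (critBH α m) (I₀ m) (fun i => p m i ω))) :
    -- the adaptive test is consistent
    Consistent P (fun m ω => FDP (critAdaptive α lam (estimate (g m) (fun i => p m i ω)))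
      (I₀ m) (fun i => p m i ω)) := by
  obtain ⟨C, hC, hA4⟩ := hA4
  have hlam0 : 0 < lam := hα.trans_le hαlam
  have hCα : α ≤ C * α := le_mul_of_one_le_left hα.le hC.le
  refine lemma5p4_general P I₀ p hBI α lam hα hαlam hlam.le (fun m => estimate (g m))
    (fun m hm => measurable_estimate (hg m hm))
    (fun m _ => invariantBelow_estimate hlam0.le (g m)) hpos κ₀ hA1
    (tendsto_measure_one_of_subset (fun m ω hω => ?_) hA4)
    C₀ ⟨(mul_pos hα hκ₀.1).trans_le hC₀.1, hC₀.2⟩ hlim hC₀one hBH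
  exact (show α / lam * _ ≤ C * α / lam * _ by gcongr).trans hω
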